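/- **Setting.** A *filter* is a set $C$ with an inhabited family $(\mathcal F_i)_{i\in I}$ of subsets of $C$ (the base sets) such that for all $i,j\in I$ there is $k\in I$ with $\mathcal F_k\subseteq \mathcal F_i\cap\mathcal F_j$. Filters are the objects of the category $\mathfrak F\mathbf{Set}$. A morphism $(C,(\mathcal F_i)_{i\in I})\to(D,(\mathcal G_j)_{j\in J})$ is the germ of a function $\alpha:\mathcal F_i\to D$, defined on some base set, that is continuous: for every $j\in J$ there is $i'\in I$ with $\mathcal F_{i'}\subseteq\alpha^{-1}(\mathcal G_j)$; two such functions have the same germ if they agree on a common base set. A set $S$ is identified with the filter $(S,\{S\})$. Let $K$ be the Grothendieck topology on $\mathfrak F\mathbf{Set}$ whose covers are the finite families $(\beta_k:\mathcal G_k\to\mathcal F)_{k\le n}$ such that, for every choice of base sets $\mathcal G_{k,j_k}$ (on which $\beta_k$ is defined), $\bigcup_k\beta_k(\mathcal G_{k,j_k})$ contains a base set of $\mathcal F$. Let $\mathcal N=\mathrm{Sh}(\mathfrak F\mathbf{Set},K)$, and let $\mathbf y$ be the Yoneda embedding. Let $\mathcal L$ be a many-sorted first-order language, with equality, interpreted in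 $\mathbf{Set}$, in which every type $S$ has a type $S^*$, interpreted as the set of finite sequences of elements of $S$, with the membership relation $x\in s$ for $x:S$, $s:S^*$. Types may be empty or finite. Let $\mathcal L_{\mathrm{st}}$ be $\mathcal L$ with an additional unary predicate $\mathrm{st}_S$ for each type $S$. Formulae of $\mathcal L$ are called *internal*, formulae of $\mathcal L_{\mathrm{st}}$ *external*. Interpret $\mathcal L_{\mathrm{st}}$ in $\mathcal N$ by $\llbracket S\rrbracket=\mathbf yS$, $\llbracket f\rrbracket=\mathbf yf$ for function symbols, $\llbracket R\rrbracket=\mathbf yR$ for relation symbols of $\mathcal L$, and $\llbracket\mathrm{st}_S\rrbracket=\Delta S\rightarrowtail\mathbf yS$, where $(\Delta S)(\mathcal F)$ is the set of morphisms $\mathcal F\to S$ that take only finitely many values (have a representative with finite range); logical symbols are interpreted in the usual way in the topos. A formula *holds in* $\mathcal N$ (written $\Vdash$) if its universal closure is true in $\mathcal N$ under this interpretation. Write $\exists^{\mathrm{st}}x{:}S\,\Phi$ for $\exists x{:}S\,(\mathrm{st}_S(x)\wedge\Phi)$, $\mathrm{hyper}_S(s)$ for $\forall x{:}S\,(\mathrm{st}_S(x)\to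 x\in s)$ ("$s$ is a hyperfinite enumeration of $S$"), and $\forall^{\mathrm{hyp}}s{:}S^*\,\Phi$ for $\forall s{:}S^*\,(\mathrm{hyper}_S(s)\to\Phi)$. **Lemma.** Let $\Phi(x)$ be an external formula whose only free variable is $x:S$, and suppose $\Vdash\exists x{:}S\;\Phi(x)$. Then for every internal formula $\varphi(\vec y,x)$, with parameters $\vec y=(y_1,\dots,y_n)$ of arbitrary types $T_1,\dots,T_n$ ($n\ge 0$), $$\Vdash\;\forall\vec y\,\Big(\forall x{:}S\,\big(\Phi(x)\to\varphi(\vec y,x)\big)\;\to\;\exists^{\mathrm{st}}x{:}S\;\varphi(\vec y,x)\Big).$$ **Proposition (sequence underspill $\mathsf{US}^*$ holds in $\mathcal N$).** For every type $S$ and every internal formula $\varphi(\vec y,s)$ with $s:S^*$ and parameters $\vec y$ of arbitrary types, $$\Vdash\;\forall\vec y\,\Big(\forall^{\mathrm{hyp}}s{:}S^*\;\varphi(\vec y,s)\;\to\;\exists^{\mathrm{st}}s{:}S^*\;\varphi(\vec y,s)\Big).$$ -/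

import Mathlib

open CategoryTheory Opposite

universe u w₁ w₂ w₃

namespace FilterTopos

/-! ## The category of filters -/

/-- A filter (base) of subsets: a set `carrier` together with an inhabited family of subsets,
indexed by `Index`, any two members of which contain a third one. The filter need not be proper. -/
structure FSet : Type (u + 1) where
  carrier : Type u
  Index : Type u
  base : Index → Set carrier
  nonempty : Nonempty Index
  directed : ∀ i j, ∃ k, base k ⊆ base i ∩ base j

/-- A continuous partial map `F ⇀ G`, defined on a base set of `F`: each base set of `G` has a
preimage that contains a base set of `F`. -/
structure ContMap (F G : FSet.{u}) where
  dom : F.Index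
  toFun : F.base dom → G.carrier
  cont : ∀ j, ∃ i, ∀ v ∈ F.base i, ∃ h : v ∈ F.base dom, toFun ⟨v, h⟩ ∈ G.base j

namespace ContMap

variable {F G H : FSet.{u}}

/-- The graph of a partial map: `a.Maps v d` says that `a` is defined at `v`, with value `d`. -/
def Maps (a : ContMap F G) (v : F.carrier) (d : G.carrier) : Prop :=
  ∃ h : v ∈ F.base a.dom, a.toFun ⟨v, h⟩ = d

/-- Two partial maps have the same germ if they are both defined, and agree, on a base set. -/
def Eqv (a b : ContMap F G) : Prop :=
  ∃ k, ∀ v ∈ F.base k, ∃ (h : v ∈ F.base a.dom) (h' : v ∈ F.base b.dom),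
    a.toFun ⟨v, h⟩ = b.toFun ⟨v, h'⟩

theorem Maps.unique {a : ContMap F G} {v d d'} (h : a.Maps v d) (h' : a.Maps v d') : d = d' := by
  obtain ⟨_, rfl⟩ := h
  obtain ⟨_, rfl⟩ := h'
  rfl

theorem maps_cont (a : ContMap F G) (j) : ∃ i, ∀ v ∈ F.base i, ∃ d ∈ G.base j, a.Maps v d := by
  obtain ⟨i, hi⟩ := a.cont j
  refine ⟨i, fun v hv => ?_⟩
  obtain ⟨h, h'⟩ := hi v hv
  exact ⟨_, h', h, rfl⟩

theorem eqv_iff {a b : ContMap F G} :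
    a.Eqv b ↔ ∃ k, ∀ v ∈ F.base k, ∃ d, a.Maps v d ∧ b.Maps v d := by
  constructor
  · rintro ⟨k, hk⟩
    refine ⟨k, fun v hv => ?_⟩
    obtain ⟨h, h', e⟩ := hk v hv
    exact ⟨_, ⟨h, rfl⟩, ⟨h', e.symm⟩⟩
  · rintro ⟨k, hk⟩
    refine ⟨k, fun v hv => ?_⟩
    obtain ⟨d, ⟨h, e⟩, ⟨h', e'⟩⟩ := hk v hv
    exact ⟨h, h', e.trans e'.symm⟩

theorem eqv_equivalence : Equivalence (Eqv (F := F) (G := G)) where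
  refl a := ⟨a.dom, fun _ hv => ⟨hv, hv, rfl⟩⟩
  symm := by
    rintro a b ⟨k, hk⟩
    refine ⟨k, fun v hv => ?_⟩
    obtain ⟨h, h', e⟩ := hk v hv
    exact ⟨h', h, e.symm⟩
  trans := by
    rintro a b c hab hbc
    rw [eqv_iff] at *
    obtain ⟨k, hk⟩ := hab
    obtain ⟨l, hl⟩ := hbc
    obtain ⟨m, hm⟩ := F.directed k l
    refine ⟨m, fun v hv => ?_⟩
    obtain ⟨d, h1, h2⟩ := hk v (hm hv).1
    obtain ⟨d', h3, h4⟩ := hl v (hm hv).2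
    obtain rfl := h2.unique h3
    exact ⟨d, h1, h4⟩

instance setoid (F G : FSet.{u}) : Setoid (ContMap F G) := ⟨Eqv, eqv_equivalence⟩

/-- The identity, defined on an arbitrary base set. -/
noncomputable def id (F : FSet.{u}) : ContMap F F where
  dom := F.nonempty.some
  toFun v := v.1
  cont j := by
    obtain ⟨k, hk⟩ := F.directed F.nonempty.some j
    exact ⟨k, fun v hv => ⟨(hk hv).1, (hk hv).2⟩⟩

/-- The composite `v ↦ b (a v)`, defined on a base set that `a` sends into the domain of `b`. -/
noncomputable def comp (a : ContMap F G) (b : ContMap G H) : ContMap F H where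
  dom := (a.cont b.dom).choose
  toFun v := b.toFun ⟨a.toFun ⟨v.1, ((a.cont b.dom).choose_spec v.1 v.2).choose⟩,
    ((a.cont b.dom).choose_spec v.1 v.2).choose_spec⟩
  cont j := by
    obtain ⟨l, hl⟩ := b.cont j
    obtain ⟨i, hi⟩ := a.cont l
    obtain ⟨k, hk⟩ := F.directed i (a.cont b.dom).choose
    refine ⟨k, fun v hv => ⟨(hk hv).2, ?_⟩⟩
    obtain ⟨h, h'⟩ := hi v (hk hv).1
    obtain ⟨_, h2⟩ := hl _ h'
    exact h2

theorem id_maps : ∃ i, ∀ v ∈ F.base i, (id F).Maps v v :=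
  ⟨F.nonempty.some, fun _ hv => ⟨hv, rfl⟩⟩

theorem comp_maps (a : ContMap F G) (b : ContMap G H) :
    ∃ i, ∀ v ∈ F.base i, ∃ d e, a.Maps v d ∧ b.Maps d e ∧ (a.comp b).Maps v e :=
  ⟨(a.comp b).dom, fun v hv => ⟨_, _,
    ⟨((a.cont b.dom).choose_spec v hv).choose, rfl⟩,
    ⟨((a.cont b.dom).choose_spec v hv).choose_spec, rfl⟩, ⟨hv, rfl⟩⟩⟩

theorem comp_eqv {a a' : ContMap F G} {b b' : ContMap G H} (ha : a ≈ a') (hb : b ≈ b') :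
    a.comp b ≈ a'.comp b' := by
  change Eqv _ _ at *
  rw [eqv_iff] at *
  obtain ⟨k, hk⟩ := ha
  obtain ⟨l, hl⟩ := hb
  obtain ⟨i1, h1⟩ := a.comp_maps b
  obtain ⟨i2, h2⟩ := a'.comp_maps b'
  obtain ⟨i3, h3⟩ := a.maps_cont l
  obtain ⟨m, hm⟩ := F.directed k i1
  obtain ⟨n, hn⟩ := F.directed i2 i3
  obtain ⟨p, hp⟩ := F.directed m n
  refine ⟨p, fun v hv => ?_⟩
  obtain ⟨d, A, B⟩ := hk v (hm (hp hv).1).1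
  obtain ⟨d1, e1, C1, C2, C3⟩ := h1 v (hm (hp hv).1).2
  obtain ⟨d2, e2, D1, D2, D3⟩ := h2 v (hn (hp hv).2).1
  obtain ⟨d3, E1, E2⟩ := h3 v (hn (hp hv).2).2
  obtain ⟨e, G1, G2⟩ := hl d3 E1
  obtain rfl := A.unique C1
  obtain rfl := B.unique D1
  obtain rfl := A.unique E2
  obtain rfl := C2.unique G1
  obtain rfl := D2.unique G2
  exact ⟨_, C3, D3⟩

end ContMap

/-- The category of filters: morphisms are germs of continuous partial maps. -/
noncomputable instance : Category FSet.{u} where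
  Hom F G := Quotient (ContMap.setoid F G)
  id F := ⟦ContMap.id F⟧
  comp := Quotient.map₂ ContMap.comp (fun _ _ ha _ _ hb => ContMap.comp_eqv ha hb)
  id_comp := by
    intro F G f
    induction f using Quotient.inductionOn with | _ a => ?_
    refine Quotient.sound (ContMap.eqv_iff.2 ?_)
    obtain ⟨i1, h1⟩ := ContMap.comp_maps (ContMap.id F) a
    obtain ⟨i2, h2⟩ := ContMap.id_maps (F := F)
    obtain ⟨k, hk⟩ := F.directed i1 i2
    refine ⟨k, fun v hv => ?_⟩
    obtain ⟨d, e, A, B, C⟩ := h1 v (hk hv).1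
    obtain rfl := A.unique (h2 v (hk hv).2)
    exact ⟨e, C, B⟩
  comp_id := by
    intro F G f
    induction f using Quotient.inductionOn with | _ a => ?_
    refine Quotient.sound (ContMap.eqv_iff.2 ?_)
    obtain ⟨i1, h1⟩ := ContMap.comp_maps a (ContMap.id G)
    obtain ⟨i2, h2⟩ := ContMap.id_maps (F := G)
    obtain ⟨i3, h3⟩ := a.maps_cont i2
    obtain ⟨k, hk⟩ := F.directed i1 i3
    refine ⟨k, fun v hv => ?_⟩
    obtain ⟨d, e, A, B, C⟩ := h1 v (hk hv).1
    obtain ⟨d', D, E⟩ := h3 v (hk hv).2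
    obtain rfl := A.unique E
    obtain rfl := B.unique (h2 _ D)
    exact ⟨_, C, A⟩
  assoc := by
    intro F G H I f g h
    induction f using Quotient.inductionOn with | _ a => ?_
    induction g using Quotient.inductionOn with | _ b => ?_
    induction h using Quotient.inductionOn with | _ c => ?_
    refine Quotient.sound (ContMap.eqv_iff.2 ?_)
    obtain ⟨i1, h1⟩ := (a.comp b).comp_maps c
    obtain ⟨i2, h2⟩ := a.comp_maps b
    obtain ⟨i3, h3⟩ := a.comp_maps (b.comp c)
    obtain ⟨i4, h4⟩ := b.comp_maps c
    obtain ⟨i5, h5⟩ := a.maps_cont i4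
    obtain ⟨k, hk⟩ := F.directed i1 i2
    obtain ⟨l, hl⟩ := F.directed i3 i5
    obtain ⟨m, hm⟩ := F.directed k l
    refine ⟨m, fun v hv => ?_⟩
    obtain ⟨d1, e1, A1, A2, A3⟩ := h1 v (hk (hm hv).1).1
    obtain ⟨d2, e2, B1, B2, B3⟩ := h2 v (hk (hm hv).1).2
    obtain ⟨d3, e3, C1, C2, C3⟩ := h3 v (hl (hm hv).2).1
    obtain ⟨d5, E1, E2⟩ := h5 v (hl (hm hv).2).2
    obtain ⟨d4, e4, D1, D2, D3⟩ := h4 d5 E1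
    obtain rfl := A1.unique B3
    obtain rfl := B1.unique C1
    obtain rfl := B1.unique E2
    obtain rfl := B2.unique D1
    obtain rfl := C2.unique D3
    obtain rfl := A2.unique D2
    exact ⟨_, A3, C3⟩

/-- The germ of a continuous partial map. -/
def germ {F G : FSet.{u}} (a : ContMap F G) : F ⟶ G := Quotient.mk (ContMap.setoid F G) a

theorem germ_surj {F G : FSet.{u}} (f : F ⟶ G) : ∃ a, germ a = f := Quotient.exists_rep f

theorem germ_comp {F G H : FSet.{u}} (a : ContMap F G) (b : ContMap G H) :
    germ a ≫ germ b = germ (a.comp b) := rfl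

theorem germ_eq_iff {F G : FSet.{u}} {a b : ContMap F G} :
    germ a = germ b ↔ ∃ k, ∀ v ∈ F.base k, ∃ d, a.Maps v d ∧ b.Maps v d :=
  Quotient.eq.trans ContMap.eqv_iff

theorem FSet.finite_directed (F : FSet.{u}) {ι : Type*} [Finite ι] (j : ι → F.Index) :
    ∃ k, ∀ x, F.base k ⊆ F.base (j x) := by
  classical
  cases nonempty_fintype ι
  have : ∀ s : Finset ι, ∃ k, ∀ x ∈ s, F.base k ⊆ F.base (j x) := by
    intro s
    induction s using Finset.induction_on with
    | empty => exact ⟨F.nonempty.some, by simp⟩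
    | insert a s _ ih =>
      obtain ⟨k, hk⟩ := ih
      obtain ⟨l, hl⟩ := F.directed k (j a)
      refine ⟨l, fun x hx => ?_⟩
      rcases Finset.mem_insert.1 hx with rfl | hx
      · exact fun v hv => (hl hv).2
      · exact fun v hv => hk x hx (hl hv).1
  obtain ⟨k, hk⟩ := this Finset.univ
  exact ⟨k, fun x => hk x (Finset.mem_univ x)⟩

/-- The simple filter `(S, {S})` of a set `S`. -/
def ofSet (S : Type u) : FSet.{u} where
  carrier := S
  Index := PUnit
  base _ := Set.univ
  nonempty := ⟨⟨⟩⟩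
  directed _ _ := ⟨⟨⟩, by simp⟩

/-- The embedding of sets into filters, on functions. -/
def ofFun {S T : Type u} (f : S → T) : ofSet S ⟶ ofSet T :=
  germ ⟨⟨⟩, fun x => f x.1, fun _ => ⟨⟨⟩, fun _ _ => ⟨trivial, trivial⟩⟩⟩

/-! ## The topology of finite covers, and the topos -/

/-- A family of morphisms `β k : G k ⟶ F` covers `F` if, whatever base sets of the `G k` are
chosen, the union of their images contains a base set of `F`. -/
def Covers {F : FSet.{u}} {ι : Type} (G : ι → FSet.{u}) (β : ∀ k, G k ⟶ F) : Prop :=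
  ∀ b : ∀ k, ContMap (G k) F, (∀ k, germ (b k) = β k) →
    ∀ j : ∀ k, (G k).Index, ∃ i, ∀ v ∈ F.base i, ∃ k, ∃ w ∈ (G k).base (j k), (b k).Maps w v

/-- It suffices to check the covering condition on one choice of representatives. -/
theorem covers_of_rep {F : FSet.{u}} {ι : Type} {G : ι → FSet.{u}} (b : ∀ k, ContMap (G k) F)
    (h : ∀ j : ∀ k, (G k).Index, ∃ i, ∀ v ∈ F.base i, ∃ k, ∃ w ∈ (G k).base (j k),
      (b k).Maps w v) : Covers G (fun k => germ (b k)) := by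
  intro b' hb' j
  have key : ∀ k, ∃ l, ∀ w ∈ (G k).base l, w ∈ (G k).base (j k) ∧
      ∃ d, (b' k).Maps w d ∧ (b k).Maps w d := by
    intro k
    obtain ⟨m, hm⟩ := germ_eq_iff.1 (hb' k)
    obtain ⟨l, hl⟩ := (G k).directed m (j k)
    exact ⟨l, fun w hw => ⟨(hl hw).2, hm w (hl hw).1⟩⟩
  choose l hl using key
  obtain ⟨i, hi⟩ := h l
  refine ⟨i, fun v hv => ?_⟩
  obtain ⟨k, w, hw, e⟩ := hi v hv
  obtain ⟨h1, d, h2, h3⟩ := hl k w hw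
  obtain rfl := e.unique h3
  exact ⟨k, w, h1, h2⟩

section Pullback

variable {F G H : FSet.{u}} (a : ContMap G F) (c : ContMap H F)

/-- The fibre product of two continuous partial maps. -/
def pb : FSet.{u} where
  carrier := G.carrier × H.carrier
  Index := G.Index × H.Index
  base p := {x | x.1 ∈ G.base p.1 ∧ x.2 ∈ H.base p.2 ∧ ∃ z, a.Maps x.1 z ∧ c.Maps x.2 z}
  nonempty := ⟨(G.nonempty.some, H.nonempty.some)⟩
  directed p q := by
    obtain ⟨k, hk⟩ := G.directed p.1 q.1
    obtain ⟨l, hl⟩ := H.directed p.2 q.2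
    exact ⟨(k, l), fun x hx => ⟨⟨(hk hx.1).1, (hl hx.2.1).1, hx.2.2⟩,
      ⟨(hk hx.1).2, (hl hx.2.1).2, hx.2.2⟩⟩⟩

/-- The first projection of the fibre product. -/
noncomputable def pbFst : ContMap (pb a c) G where
  dom := (pb a c).nonempty.some
  toFun x := x.1.1
  cont j := by
    obtain ⟨k, hk⟩ := (pb a c).directed (pb a c).nonempty.some (j, H.nonempty.some)
    exact ⟨k, fun v hv => ⟨(hk hv).1, (hk hv).2.1⟩⟩

/-- The second projection of the fibre product. -/
noncomputable def pbSnd : ContMap (pb a c) H where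
  dom := (pb a c).nonempty.some
  toFun x := x.1.2
  cont j := by
    obtain ⟨k, hk⟩ := (pb a c).directed (pb a c).nonempty.some (G.nonempty.some, j)
    exact ⟨k, fun v hv => ⟨(hk hv).1, (hk hv).2.2.1⟩⟩

theorem pb_maps : ∃ k, ∀ x ∈ (pb a c).base k,
    (pbFst a c).Maps x x.1 ∧ (pbSnd a c).Maps x x.2 ∧ ∃ z, a.Maps x.1 z ∧ c.Maps x.2 z :=
  ⟨(pb a c).nonempty.some, fun _ hx => ⟨⟨hx, rfl⟩, ⟨hx, rfl⟩, hx.2.2⟩⟩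

theorem pb_comm : germ (pbFst a c) ≫ germ a = germ (pbSnd a c) ≫ germ c := by
  rw [germ_comp, germ_comp, germ_eq_iff]
  obtain ⟨k1, h1⟩ := pb_maps a c
  obtain ⟨k2, h2⟩ := (pbFst a c).comp_maps a
  obtain ⟨k3, h3⟩ := (pbSnd a c).comp_maps c
  obtain ⟨m, hm⟩ := (pb a c).directed k1 k2
  obtain ⟨n, hn⟩ := (pb a c).directed m k3
  refine ⟨n, fun x hx => ?_⟩
  obtain ⟨A1, A2, z, A3, A4⟩ := h1 x (hm (hn hx).1).1
  obtain ⟨d, e, B1, B2, B3⟩ := h2 x (hm (hn hx).1).2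
  obtain ⟨d', e', C1, C2, C3⟩ := h3 x (hn hx).2
  obtain rfl := A1.unique B1
  obtain rfl := A2.unique C1
  obtain rfl := A3.unique B2
  obtain rfl := A4.unique C2
  exact ⟨_, B3, C3⟩

end Pullback

theorem covers_pb {F H : FSet.{u}} {ι : Type} [Finite ι] {G : ι → FSet.{u}}
    (b : ∀ k, ContMap (G k) F) (hb : Covers G (fun k => germ (b k))) (c : ContMap H F) :
    Covers (fun k => pb (b k) c) (fun k => germ (pbSnd (b k) c)) := by
  apply covers_of_rep
  intro j
  have key : ∀ k, ∃ m : (pb (b k) c).Index, ∀ x ∈ (pb (b k) c).base m,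
      x ∈ (pb (b k) c).base (j k) ∧ (pbSnd (b k) c).Maps x x.2 := by
    intro k
    obtain ⟨l, hl⟩ := pb_maps (b k) c
    obtain ⟨m, hm⟩ := (pb (b k) c).directed (j k) l
    exact ⟨m, fun x hx => ⟨(hm hx).1, (hl x (hm hx).2).2.1⟩⟩
  choose m hm using key
  obtain ⟨i0, hi0⟩ := hb b (fun _ => rfl) (fun k => (m k).1)
  obtain ⟨l1, hl1⟩ := c.maps_cont i0
  obtain ⟨l2, hl2⟩ := H.finite_directed (fun k => (m k).2)
  obtain ⟨l, hl⟩ := H.directed l1 l2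
  refine ⟨l, fun v hv => ?_⟩
  obtain ⟨z, hz, hvz⟩ := hl1 v (hl hv).1
  obtain ⟨k, w, hw, hwz⟩ := hi0 z hz
  obtain ⟨h1, h2⟩ := hm k (w, v) ⟨hw, hl2 k (hl hv).2, z, hwz, hvz⟩
  exact ⟨k, (w, v), h1, h2⟩

theorem covers_bind {F : FSet.{u}} {ι : Type} {G : ι → FSet.{u}}
    (b : ∀ k, ContMap (G k) F) (hb : Covers G (fun k => germ (b k)))
    {κ : ι → Type} {H : ∀ k, κ k → FSet.{u}} (c : ∀ k m, ContMap (H k m) (G k))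
    (hc : ∀ k, Covers (H k) (fun m => germ (c k m))) :
    Covers (ι := Σ k, κ k) (fun p => H p.1 p.2) (fun p => germ ((c p.1 p.2).comp (b p.1))) := by
  apply covers_of_rep
  intro j
  have key : ∀ k m, ∃ l, ∀ x ∈ (H k m).base l, x ∈ (H k m).base (j ⟨k, m⟩) ∧
      ∃ d e, (c k m).Maps x d ∧ (b k).Maps d e ∧ ((c k m).comp (b k)).Maps x e := by
    intro k m
    obtain ⟨i, hi⟩ := (c k m).comp_maps (b k)
    obtain ⟨l, hl⟩ := (H k m).directed (j ⟨k, m⟩) i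
    exact ⟨l, fun x hx => ⟨(hl hx).1, hi x (hl hx).2⟩⟩
  choose l hl using key
  have key2 := fun k => hc k (c k) (fun _ => rfl) (l k)
  choose i1 hi1 using key2
  obtain ⟨i, hi⟩ := hb b (fun _ => rfl) i1
  refine ⟨i, fun v hv => ?_⟩
  obtain ⟨k, w, hw, h1⟩ := hi v hv
  obtain ⟨m, x, hx, h2⟩ := hi1 k w hw
  obtain ⟨h3, d, e, h4, h5, h6⟩ := hl k m x hx
  obtain rfl := h2.unique h4
  obtain rfl := h1.unique h5
  exact ⟨⟨k, m⟩, x, h3, h6⟩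

/-- The topology `K`: a sieve is covering if it contains a finite covering family. -/
def K : GrothendieckTopology FSet.{u} where
  sieves F := {S | ∃ (ι : Type) (_ : Finite ι) (G : ι → FSet.{u}) (β : ∀ k, G k ⟶ F),
    (∀ k, S (β k)) ∧ Covers G β}
  top_mem' F := by
    refine ⟨Unit, inferInstance, fun _ => F, fun _ => germ (ContMap.id F), fun _ => trivial, ?_⟩
    apply covers_of_rep
    intro j
    obtain ⟨i, hi⟩ := ContMap.id_maps (F := F)
    obtain ⟨k, hk⟩ := F.directed i (j ())
    exact ⟨k, fun v hv => ⟨(), v, (hk hv).2, hi v (hk hv).1⟩⟩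
  pullback_stable' := by
    rintro F H S f ⟨ι, hι, G, β, hS, hβ⟩
    obtain ⟨c, rfl⟩ := germ_surj f
    choose b hb using fun k => germ_surj (β k)
    obtain rfl : (fun k => germ (b k)) = β := funext hb
    refine ⟨ι, hι, _, _, fun k => ?_, covers_pb b hβ c⟩
    change S _
    rw [← pb_comm]
    exact S.downward_closed (hS k) _
  transitive' := by
    rintro F S ⟨ι, hι, G, β, hS, hβ⟩ R hR
    choose b hb using fun k => germ_surj (β k)
    obtain rfl : (fun k => germ (b k)) = β := funext hb
    have hR' := fun k => hR (hS k)
    choose κ hκ H γ h1 h2 using hR'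
    choose c hc using fun k m => germ_surj (γ k m)
    obtain rfl : (fun k m => germ (c k m)) = γ := funext fun k => funext fun m => hc k m
    exact ⟨Σ k, κ k, inferInstance, _, _, fun p => h1 p.1 p.2, covers_bind b hβ c h2⟩

/-- Morphisms of filters are determined on covers. -/
theorem hom_ext_of_covers {F D : FSet.{u}} {ι : Type} {G : ι → FSet.{u}} (β : ∀ k, G k ⟶ F)
    (hβ : Covers G β) (s t : F ⟶ D) (h : ∀ k, β k ≫ s = β k ≫ t) : s = t := by
  choose b hb using fun k => germ_surj (β k)
  obtain rfl : (fun k => germ (b k)) = β := funext hb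
  obtain ⟨s, rfl⟩ := germ_surj s
  obtain ⟨t, rfl⟩ := germ_surj t
  have key : ∀ k, ∃ l, ∀ x ∈ (G k).base l, ∃ z d, (b k).Maps x z ∧ s.Maps z d ∧ t.Maps z d := by
    intro k
    have hk := h k
    simp only [germ_comp] at hk
    obtain ⟨l1, h1⟩ := germ_eq_iff.1 hk
    obtain ⟨l2, h2⟩ := (b k).comp_maps s
    obtain ⟨l3, h3⟩ := (b k).comp_maps t
    obtain ⟨m, hm⟩ := (G k).directed l1 l2
    obtain ⟨n, hn⟩ := (G k).directed m l3
    refine ⟨n, fun x hx => ?_⟩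
    obtain ⟨d, A1, A2⟩ := h1 x (hm (hn hx).1).1
    obtain ⟨z, e, B1, B2, B3⟩ := h2 x (hm (hn hx).1).2
    obtain ⟨z', e', C1, C2, C3⟩ := h3 x (hn hx).2
    obtain rfl := A1.unique B3
    obtain rfl := A2.unique C3
    obtain rfl := B1.unique C1
    exact ⟨_, _, B1, B2, C2⟩
  choose l hl using key
  obtain ⟨i, hi⟩ := hβ b (fun _ => rfl) l
  refine germ_eq_iff.2 ⟨i, fun v hv => ?_⟩
  obtain ⟨k, w, hw, e⟩ := hi v hv
  obtain ⟨z, d, h1, h2, h3⟩ := hl k w hw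
  obtain rfl := e.unique h1
  exact ⟨d, h2, h3⟩

/-- Matching families of morphisms can be glued along finite covers. -/
theorem exists_glue {F D : FSet.{u}} {ι : Type} [Finite ι] {G : ι → FSet.{u}}
    (b : ∀ k, ContMap (G k) F) (hb : Covers G (fun k => germ (b k)))
    (a : ∀ k, ContMap (G k) D)
    (hab : ∀ k l, germ (pbFst (b k) (b l)) ≫ germ (a k) = germ (pbSnd (b k) (b l)) ≫ germ (a l)) :
    ∃ t : F ⟶ D, ∀ k, germ (b k) ≫ t = germ (a k) := by
  classical
  have key : ∀ k l, ∃ p : (G k).Index × (G l).Index, ∀ x ∈ (G k).base p.1, ∀ y ∈ (G l).base p.2,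
      ∀ z, (b k).Maps x z → (b l).Maps y z → ∃ d, (a k).Maps x d ∧ (a l).Maps y d := by
    intro k l
    have hkl := hab k l
    simp only [germ_comp] at hkl
    obtain ⟨p1, h1⟩ := germ_eq_iff.1 hkl
    obtain ⟨p2, h2⟩ := (pbFst (b k) (b l)).comp_maps (a k)
    obtain ⟨p3, h3⟩ := (pbSnd (b k) (b l)).comp_maps (a l)
    obtain ⟨p4, h4⟩ := pb_maps (b k) (b l)
    obtain ⟨m, hm⟩ := (pb (b k) (b l)).directed p1 p2
    obtain ⟨n, hn⟩ := (pb (b k) (b l)).directed p3 p4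
    obtain ⟨p, hp⟩ := (pb (b k) (b l)).directed m n
    refine ⟨p, fun x hx y hy z hxz hyz => ?_⟩
    have hq : ((x, y) : (pb (b k) (b l)).carrier) ∈ (pb (b k) (b l)).base p :=
      ⟨hx, hy, z, hxz, hyz⟩
    obtain ⟨d, A1, A2⟩ := h1 _ (hm (hp hq).1).1
    obtain ⟨d2, e2, B1, B2, B3⟩ := h2 _ (hm (hp hq).1).2
    obtain ⟨d3, e3, C1, C2, C3⟩ := h3 _ (hn (hp hq).2).1
    obtain ⟨D1, D2, _⟩ := h4 _ (hn (hp hq).2).2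
    obtain rfl := A1.unique B3
    obtain rfl := A2.unique C3
    obtain rfl := B1.unique D1
    obtain rfl := C1.unique D2
    exact ⟨_, B2, C2⟩
  choose p hp using key
  have key2 : ∀ k, ∃ m : (G k).Index, (∀ l, (G k).base m ⊆ (G k).base (p k l).1) ∧
      (∀ l, (G k).base m ⊆ (G k).base (p l k).2) := by
    intro k
    obtain ⟨m1, h1⟩ := (G k).finite_directed (fun l => (p k l).1)
    obtain ⟨m2, h2⟩ := (G k).finite_directed (fun l => (p l k).2)
    obtain ⟨m, hm⟩ := (G k).directed m1 m2
    exact ⟨m, fun l v hv => h1 l (hm hv).1, fun l v hv => h2 l (hm hv).2⟩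
  choose m hm1 hm2 using key2
  have agree : ∀ k l x y z, x ∈ (G k).base (m k) → y ∈ (G l).base (m l) → (b k).Maps x z →
      (b l).Maps y z → ∃ d, (a k).Maps x d ∧ (a l).Maps y d :=
    fun k l x y z hx hy hxz hyz => hp k l x (hm1 k l hx) y (hm2 l k hy) z hxz hyz
  obtain ⟨i, hi⟩ := hb b (fun _ => rfl) m
  have val : ∀ v : F.base i, ∃ d, ∃ k, ∃ w ∈ (G k).base (m k), (b k).Maps w v ∧ (a k).Maps w d := by
    rintro ⟨v, hv⟩
    obtain ⟨k, w, hw, e⟩ := hi v hv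
    obtain ⟨d, h1, -⟩ := agree k k w w v hw hw e e
    exact ⟨d, k, w, hw, e, h1⟩
  choose t ht using val
  have ht' : ∀ k w v (hv : v ∈ F.base i), w ∈ (G k).base (m k) → (b k).Maps w v →
      (a k).Maps w (t ⟨v, hv⟩) := by
    intro k w v hv hw e
    obtain ⟨k', w', hw', e', h⟩ := ht ⟨v, hv⟩
    obtain ⟨d, h1, h2⟩ := agree k k' w w' v hw hw' e e'
    obtain rfl := h.unique h2
    exact h1
  let T : ContMap F D :=
    { dom := i
      toFun := t
      cont := by
        intro j
        have : ∀ k, ∃ n, ∀ w ∈ (G k).base n, w ∈ (G k).base (m k) ∧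
            ∃ d ∈ D.base j, (a k).Maps w d := by
          intro k
          obtain ⟨n1, h1⟩ := (a k).maps_cont j
          obtain ⟨n, hn⟩ := (G k).directed n1 (m k)
          exact ⟨n, fun w hw => ⟨(hn hw).2, h1 w (hn hw).1⟩⟩
        choose n hn using this
        obtain ⟨i1, h1⟩ := hb b (fun _ => rfl) n
        obtain ⟨i2, h2⟩ := F.directed i1 i
        refine ⟨i2, fun v hv => ⟨(h2 hv).2, ?_⟩⟩
        obtain ⟨k, w, hw, e⟩ := h1 v (h2 hv).1
        obtain ⟨h3, d, h4, h5⟩ := hn k w hw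
        obtain rfl := h5.unique (ht' k w v (h2 hv).2 h3 e)
        exact h4 }
  refine ⟨germ T, fun k => ?_⟩
  rw [germ_comp, germ_eq_iff]
  obtain ⟨n1, h1⟩ := (b k).comp_maps T
  obtain ⟨n, hn⟩ := (G k).directed n1 (m k)
  refine ⟨n, fun w hw => ?_⟩
  obtain ⟨z, e, A1, ⟨hz, rfl⟩, A3⟩ := h1 w (hn hw).1
  exact ⟨_, A3, ht' k w z hz (hn hw).2 A1⟩

theorem yoneda_isSheaf (D : FSet.{u}) : Presieve.IsSheaf K (yoneda.obj D) := by
  rintro F S ⟨ι, hι, G, β, hS, hβ⟩ x hx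
  choose b hb using fun k => germ_surj (β k)
  obtain rfl : (fun k => germ (b k)) = β := funext hb
  choose a ha using fun k => germ_surj (x (germ (b k)) (hS k))
  obtain ⟨t, ht⟩ := exists_glue b hβ a (by
    intro k l
    rw [ha, ha]
    exact hx _ _ (hS k) (hS l) (pb_comm (b k) (b l)))
  refine ⟨t, ?_, ?_⟩
  · intro Y f hf
    obtain ⟨c, rfl⟩ := germ_surj f
    refine hom_ext_of_covers _ (covers_pb b hβ c) _ _ fun k => ?_
    have h1 : germ (pbFst (b k) c) ≫ x (germ (b k)) (hS k) =
        germ (pbSnd (b k) c) ≫ x (germ c) hf := hx _ _ (hS k) hf (pb_comm (b k) c)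
    change germ (pbSnd (b k) c) ≫ (germ c ≫ t) = germ (pbSnd (b k) c) ≫ x (germ c) hf
    rw [← h1, ← Category.assoc, ← pb_comm, Category.assoc, ht, ha]
  · intro t' ht'
    refine hom_ext_of_covers _ hβ _ _ fun k => ?_
    rw [ht, ha]
    exact ht' _ (hS k)

instance : (K.{u}).Subcanonical := .of_isSheaf_yoneda_obj _ yoneda_isSheaf

/-- The filter topos `𝓝 = Sh(𝔉Set, K)`. -/
abbrev NTopos : Type (u + 1) := Sheaf K.{u} (Type u)

/-- The object `𝐲S` of the topos, for a set `S`. -/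
noncomputable abbrev ySet (S : Type u) : NTopos.{u} := K.yoneda.obj (ofSet S)

/-- The morphism `𝐲f : 𝐲S ⟶ 𝐲T`, for a function `f : S → T`. -/
noncomputable abbrev yFun {S T : Type u} (f : S → T) : ySet S ⟶ ySet T := K.yoneda.map (ofFun f)

/-! ## Operations on subobjects

Subobjects of a sheaf `X` are represented by the subfunctors of `X` that are sheaves. Meets and
inverse images are computed pointwise; joins and direct images are computed by sheafifying the
pointwise ones. -/

/-- Heyting implication of subobjects. -/
def himp {X : NTopos.{u}} (A B : Subfunctor X.obj) : Subfunctor X.obj where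
  obj U := {s | ∀ ⦃V⦄ (f : U ⟶ V), X.obj.map f s ∈ A.obj V → X.obj.map f s ∈ B.obj V}
  map := by
    intro U V i s hs W f
    simpa using hs (i ≫ f)

theorem le_himp_iff {X : NTopos.{u}} (A B C : Subfunctor X.obj) : C ≤ himp A B ↔ C ⊓ A ≤ B := by
  constructor
  · intro h U s hs
    simpa using h U hs.1 (𝟙 U) (by simpa using hs.2)
  · intro h U s hs V f hf
    exact h V ⟨C.map f hs, hf⟩

/-- Universal quantification of subobjects along `p : X ⟶ Y`. -/
def forallAlong {X Y : NTopos.{u}} (p : X ⟶ Y) (A : Subfunctor X.obj) : Subfunctor Y.obj where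
  obj U := {s | ∀ ⦃V⦄ (f : U ⟶ V) (x : X.obj.obj V), p.hom.app V x = Y.obj.map f s → x ∈ A.obj V}
  map := by
    intro U V i s hs W f x hx
    exact hs (i ≫ f) x (by simpa using hx)

theorem le_forallAlong_iff {X Y : NTopos.{u}} (p : X ⟶ Y) (A : Subfunctor X.obj)
    (C : Subfunctor Y.obj) : C ≤ forallAlong p A ↔ C.preimage p.hom ≤ A := by
  constructor
  · intro h U x hx
    exact h U hx (𝟙 U) x (by simp)
  · intro h U s hs V f x hx
    refine h V ?_
    change p.hom.app V x ∈ C.obj V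
    rw [hx]
    exact C.map f hs

/-- Existential quantification of subobjects along `p : X ⟶ Y`. -/
noncomputable def existsAlong {X Y : NTopos.{u}} (p : X ⟶ Y) (A : Subfunctor X.obj) :
    Subfunctor Y.obj := (A.image p.hom).sheafify K

/-- Join of subobjects. -/
noncomputable def join {X : NTopos.{u}} (A B : Subfunctor X.obj) : Subfunctor X.obj := (A ⊔ B).sheafify K

/-- The least subobject. -/
noncomputable def least (X : NTopos.{u}) : Subfunctor X.obj := (⊥ : Subfunctor X.obj).sheafify K

/-- The equaliser of two morphisms, as a subobject. -/
def equaliser {X Y : NTopos.{u}} (f g : X ⟶ Y) : Subfunctor X.obj where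
  obj U := {s | f.hom.app U s = g.hom.app U s}
  map := by
    intro U V i s hs
    change f.hom.app V _ = g.hom.app V _
    rw [NatTrans.naturality_apply, NatTrans.naturality_apply]
    exact congrArg _ hs

/-- The subobject `𝐲R ↣ 𝐲S` given by a subset `R` of `S`. -/
noncomputable def ySub {S : Type u} (R : Set S) : Subfunctor (ySet S).obj :=
  Subfunctor.range (yFun (Subtype.val : R → S)).hom

/-- The constant object `ΔS`, as a subobject of `𝐲S`: the germs `F ⟶ S` that take a finite number
of values. -/
def delta (S : Type u) : Subfunctor (ySet S).obj where
  obj U := {α : unop U ⟶ ofSet S |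
    ∃ a : ContMap (unop U) (ofSet S), germ a = α ∧ (Set.range a.toFun).Finite}
  map := by
    rintro U V i _ ⟨a, rfl, ha⟩
    obtain ⟨c, hc⟩ := germ_surj i.unop
    refine ⟨c.comp a, ?_, ha.subset ?_⟩
    · rw [← germ_comp, hc]
      rfl
    · rintro _ ⟨v, rfl⟩
      exact ⟨_, rfl⟩

/-! The subobjects so constructed are sheaves. -/

theorem isSheaf_type (X : NTopos.{u}) : Presieve.IsSheaf K X.obj :=
  (isSheaf_iff_isSheaf_of_type _ _).1 X.property

theorem isSheaf_iff_closed {X : NTopos.{u}} (A : Subfunctor X.obj) :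
    Presieve.IsSheaf K A.toFunctor ↔ ∀ U (s : X.obj.obj U),
      A.sieveOfSection s ∈ K (unop U) → s ∈ A.obj U :=
  Subfunctor.isSheaf_iff _ (isSheaf_type X)

theorem inf_isSheaf {X : NTopos.{u}} {A B : Subfunctor X.obj}
    (hA : Presieve.IsSheaf K A.toFunctor) (hB : Presieve.IsSheaf K B.toFunctor) :
    Presieve.IsSheaf K (A ⊓ B).toFunctor := by
  rw [isSheaf_iff_closed] at *
  exact fun U s hs => ⟨hA U s (K.superset_covering (by intro V f h; exact h.1) hs),
    hB U s (K.superset_covering (by intro V f h; exact h.2) hs)⟩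

theorem preimage_isSheaf {X Y : NTopos.{u}} (p : X ⟶ Y) {A : Subfunctor Y.obj}
    (hA : Presieve.IsSheaf K A.toFunctor) :
    Presieve.IsSheaf K (A.preimage p.hom).toFunctor := by
  rw [isSheaf_iff_closed] at *
  refine fun U s hs => hA U _ (K.superset_covering ?_ hs)
  intro V f h
  change Y.obj.map f.op (p.hom.app U s) ∈ A.obj _
  rw [← NatTrans.naturality_apply]
  exact h

theorem himp_isSheaf {X : NTopos.{u}} (A : Subfunctor X.obj) {B : Subfunctor X.obj}
    (hB : Presieve.IsSheaf K B.toFunctor) : Presieve.IsSheaf K (himp A B).toFunctor := by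
  rw [isSheaf_iff_closed] at *
  intro U s hs V f hf
  refine hB V _ (K.superset_covering ?_ (K.pullback_stable f.unop hs))
  intro W g hg
  have h1 := A.map g.op hf
  have h2 : X.obj.map (𝟙 (op W)) (X.obj.map (g ≫ f.unop).op s) ∈ A.obj (op W) →
      X.obj.map (𝟙 (op W)) (X.obj.map (g ≫ f.unop).op s) ∈ B.obj (op W) := hg (𝟙 _)
  have e : X.obj.map (𝟙 (op W)) (X.obj.map (g ≫ f.unop).op s) =
      X.obj.map g.op (X.obj.map f s) := by simp
  rw [e] at h2
  exact h2 h1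

theorem forallAlong_isSheaf {X Y : NTopos.{u}} (p : X ⟶ Y) {A : Subfunctor X.obj}
    (hA : Presieve.IsSheaf K A.toFunctor) : Presieve.IsSheaf K (forallAlong p A).toFunctor := by
  rw [isSheaf_iff_closed] at *
  intro U s hs V f x hx
  refine hA V _ (K.superset_covering ?_ (K.pullback_stable f.unop hs))
  intro W g hg
  refine hg (𝟙 _) _ ?_
  rw [NatTrans.naturality_apply, hx]
  simp

theorem equaliser_isSheaf {X Y : NTopos.{u}} (f g : X ⟶ Y) :
    Presieve.IsSheaf K (equaliser f g).toFunctor := by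
  rw [isSheaf_iff_closed]
  intro U s hs
  refine (isSheaf_type Y _ hs).isSeparatedFor.ext ?_
  intro V i hi
  rw [← NatTrans.naturality_apply, ← NatTrans.naturality_apply]
  exact hi

theorem ofFun_maps {S T : Type u} {F : FSet.{u}} (a : ContMap F (ofSet S)) (f : S → T)
    (b : ContMap F (ofSet T)) : germ a ≫ ofFun f = germ b ↔
      ∃ k, ∀ v ∈ F.base k, ∃ x, a.Maps v x ∧ b.Maps v (f x) := by
  unfold ofFun
  rw [germ_comp, germ_eq_iff]
  obtain ⟨l, hl⟩ := a.comp_maps (⟨⟨⟩, fun x => f x.1, fun _ => ⟨⟨⟩, fun _ _ => ⟨trivial, trivial⟩⟩⟩ :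
    ContMap (ofSet S) (ofSet T))
  constructor <;> rintro ⟨k, hk⟩ <;> obtain ⟨m, hm⟩ := F.directed k l <;>
    refine ⟨m, fun v hv => ?_⟩ <;> obtain ⟨d, e, h1, ⟨_, rfl⟩, h3⟩ := hl v (hm hv).2
  · obtain ⟨d', h4, h5⟩ := hk v (hm hv).1
    obtain rfl := h3.unique h4
    exact ⟨d, h1, h5⟩
  · obtain ⟨x, h4, h5⟩ := hk v (hm hv).1
    obtain rfl := h1.unique h4
    exact ⟨_, h3, h5⟩

/-- A germ belongs to `𝐲R` if and only if its values on some base set are in `R`. -/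
theorem mem_ySub {S : Type u} (R : Set S) {F : FSet.{u}} (a : ContMap F (ofSet S)) :
    (germ a : F ⟶ ofSet S) ∈ (ySub R).obj (op F) ↔
      ∃ i, ∀ v ∈ F.base i, ∃ x ∈ R, a.Maps v x := by
  constructor
  · rintro ⟨c, hc⟩
    obtain ⟨c, rfl⟩ := germ_surj c
    obtain ⟨k, hk⟩ := (ofFun_maps c (Subtype.val : R → S) a).1 hc
    refine ⟨k, fun v hv => ?_⟩
    obtain ⟨x, -, h⟩ := hk v hv
    exact ⟨x.1, x.2, h⟩
  · rintro ⟨i, hi⟩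
    choose x hx using hi
    let c : ContMap F (ofSet R) := ⟨i, fun v => ⟨x v.1 v.2, (hx v.1 v.2).1⟩,
      fun _ => ⟨i, fun v hv => ⟨hv, trivial⟩⟩⟩
    exact ⟨germ c, (ofFun_maps c (Subtype.val : R → S) a).2
      ⟨i, fun v hv => ⟨_, ⟨hv, rfl⟩, (hx v hv).2⟩⟩⟩

theorem ySub_isSheaf {S : Type u} (R : Set S) : Presieve.IsSheaf K (ySub R).toFunctor := by
  rw [isSheaf_iff_closed]
  rintro ⟨F⟩ s ⟨ι, hι, G, β, hS, hβ⟩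
  change F ⟶ ofSet S at s
  obtain ⟨a, rfl⟩ := germ_surj s
  choose b hb using fun k => germ_surj (β k)
  obtain rfl : (fun k => germ (b k)) = β := funext hb
  have key : ∀ k, ∃ l, ∀ w ∈ (G k).base l, ∃ z x, (b k).Maps w z ∧ a.Maps z x ∧ x ∈ R := by
    intro k
    have hk : (germ ((b k).comp a) : G k ⟶ ofSet S) ∈ (ySub R).obj (op (G k)) := hS k
    obtain ⟨i1, h1⟩ := (mem_ySub _ _).1 hk
    obtain ⟨i2, h2⟩ := (b k).comp_maps a
    obtain ⟨m, hm⟩ := (G k).directed i1 i2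
    refine ⟨m, fun w hw => ?_⟩
    obtain ⟨x, hx, e⟩ := h1 w (hm hw).1
    obtain ⟨d, e', A1, A2, A3⟩ := h2 w (hm hw).2
    obtain rfl := e.unique A3
    exact ⟨_, _, A1, A2, hx⟩
  choose l hl using key
  obtain ⟨i, hi⟩ := hβ b (fun _ => rfl) l
  refine (mem_ySub _ _).2 ⟨i, fun v hv => ?_⟩
  obtain ⟨k, w, hw, e⟩ := hi v hv
  obtain ⟨z, x, h1, h2, h3⟩ := hl k w hw
  obtain rfl := e.unique h1
  exact ⟨x, h3, h2⟩

/-- A germ belongs to `ΔS` if and only if its values on some base set are in a finite set. -/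
theorem mem_delta {S : Type u} {F : FSet.{u}} (a : ContMap F (ofSet S)) :
    (germ a : F ⟶ ofSet S) ∈ (delta S).obj (op F) ↔
      ∃ R : Set S, R.Finite ∧ ∃ i, ∀ v ∈ F.base i, ∃ x ∈ R, a.Maps v x := by
  constructor
  · rintro ⟨b, hb, hfin⟩
    obtain ⟨k, hk⟩ := germ_eq_iff.1 hb
    refine ⟨_, hfin, k, fun v hv => ?_⟩
    obtain ⟨d, ⟨h, e⟩, h'⟩ := hk v hv
    exact ⟨d, ⟨_, e⟩, h'⟩
  · rintro ⟨R, hR, i, hi⟩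
    choose x hx using hi
    refine ⟨⟨i, fun v => x v.1 v.2, fun _ => ⟨i, fun v hv => ⟨hv, trivial⟩⟩⟩, ?_, hR.subset ?_⟩
    · exact germ_eq_iff.2 ⟨i, fun v hv => ⟨_, ⟨hv, rfl⟩, (hx v hv).2⟩⟩
    · rintro _ ⟨v, rfl⟩
      exact (hx v.1 v.2).1

theorem delta_isSheaf (S : Type u) : Presieve.IsSheaf K (delta S).toFunctor := by
  rw [isSheaf_iff_closed]
  rintro ⟨F⟩ s ⟨ι, hι, G, β, hS, hβ⟩
  change F ⟶ ofSet S at s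
  obtain ⟨a, rfl⟩ := germ_surj s
  choose b hb using fun k => germ_surj (β k)
  obtain rfl : (fun k => germ (b k)) = β := funext hb
  have hS' : ∀ k, (germ ((b k).comp a) : G k ⟶ ofSet S) ∈ (delta S).obj (op (G k)) := hS
  choose R hR hRa using fun k => (mem_delta _).1 (hS' k)
  refine (mem_delta a).2 ⟨⋃ k, R k, Set.finite_iUnion hR, ?_⟩
  refine (mem_ySub _ _).1 ((isSheaf_iff_closed _).1 (ySub_isSheaf (⋃ k, R k)) (op F) (germ a)
    ⟨ι, hι, G, _, fun k => ?_, hβ⟩)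
  refine (mem_ySub _ ((b k).comp a)).2 ?_
  obtain ⟨i, hi⟩ := hRa k
  refine ⟨i, fun v hv => ?_⟩
  obtain ⟨x, hx, e⟩ := hi v hv
  exact ⟨x, Set.mem_iUnion.2 ⟨k, hx⟩, e⟩

/-! ## Many-sorted languages with finite sequence types -/

/-- The types generated by a set of base types and the clause that `S*` is a type if `S` is. -/
inductive Ty (B : Type w₁) : Type w₁
  | base : B → Ty B
  | seq : Ty B → Ty B

/-- A many-sorted first-order language whose types are closed under finite sequences: a set of
base types, and function and relation symbols with given arities. -/
structure Lang where
  Base : Type w₁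
  Fn : List (Ty Base) → Ty Base → Type w₂
  Rel : List (Ty Base) → Type w₃

/-- The variables of type `S` of a context. -/
inductive Var {B : Type w₁} : List (Ty B) → Ty B → Type w₁
  | zero {Γ : List (Ty B)} {S : Ty B} : Var (S :: Γ) S
  | succ {Γ : List (Ty B)} {S T : Ty B} : Var Γ S → Var (T :: Γ) S

/-- There are no variables in the empty context. -/
def Var.elim {B : Type w₁} {α : Sort*} {S : Ty B} : Var [] S → α := nofun

/-- Terms of type `S` in a context `Γ`. -/
inductive Term (L : Lang.{w₁, w₂, w₃}) (Γ : List (Ty L.Base)) :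
    Ty L.Base → Type (max w₁ w₂)
  | var {S : Ty L.Base} : Var Γ S → Term L Γ S
  | app {Δ : List (Ty L.Base)} {S : Ty L.Base} (f : L.Fn Δ S)
      (args : ∀ T, Var Δ T → Term L Γ T) : Term L Γ S

/-- Formulae, in a context, of the language extended with the predicates `st`. -/
inductive Formula (L : Lang.{w₁, w₂, w₃}) : List (Ty L.Base) → Type (max w₁ w₂ w₃)
  | falsum {Γ} : Formula L Γ
  | eq {Γ} {S : Ty L.Base} (t t' : Term L Γ S) : Formula L Γ
  | rel {Γ Δ} (R : L.Rel Δ) (args : ∀ T, Var Δ T → Term L Γ T) : Formula L Γ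
  | mem {Γ} {S : Ty L.Base} (t : Term L Γ S) (s : Term L Γ (.seq S)) : Formula L Γ
  | st {Γ} {S : Ty L.Base} (t : Term L Γ S) : Formula L Γ
  | and {Γ} (φ ψ : Formula L Γ) : Formula L Γ
  | or {Γ} (φ ψ : Formula L Γ) : Formula L Γ
  | imp {Γ} (φ ψ : Formula L Γ) : Formula L Γ
  | all {Γ} (S : Ty L.Base) (φ : Formula L (S :: Γ)) : Formula L Γ
  | ex {Γ} (S : Ty L.Base) (φ : Formula L (S :: Γ)) : Formula L Γ

section Syntax'

variable {L : Lang.{w₁, w₂, w₃}}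

/-- Renaming of variables under a binder. -/
def liftRen {B : Type w₁} {Γ Δ : List (Ty B)} (r : ∀ T, Var Γ T → Var Δ T) (S : Ty B) :
    ∀ T, Var (S :: Γ) T → Var (S :: Δ) T
  | _, .zero => .zero
  | _, .succ x => .succ (r _ x)

/-- Renaming of the variables of a term. -/
def Term.rename {Γ Δ : List (Ty L.Base)} (r : ∀ T, Var Γ T → Var Δ T) {S : Ty L.Base} :
    Term L Γ S → Term L Δ S
  | .var x => .var (r _ x)
  | .app f args => .app f (fun T x => (args T x).rename r)

namespace Formula

/-- Renaming of the free variables of a formula. -/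
def rename {Γ Δ : List (Ty L.Base)} (r : ∀ T, Var Γ T → Var Δ T) : Formula L Γ → Formula L Δ
  | .falsum => .falsum
  | .eq t t' => .eq (t.rename r) (t'.rename r)
  | .rel R args => .rel R (fun T x => (args T x).rename r)
  | .mem t s => .mem (t.rename r) (s.rename r)
  | .st t => .st (t.rename r)
  | .and φ ψ => .and (φ.rename r) (ψ.rename r)
  | .or φ ψ => .or (φ.rename r) (ψ.rename r)
  | .imp φ ψ => .imp (φ.rename r) (ψ.rename r)
  | .all S φ => .all S (φ.rename (liftRen r S))
  | .ex S φ => .ex S (φ.rename (liftRen r S))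

/-- A formula `Φ(x)` whose only free variable is `x`, in a context with further variables. -/
def weaken {S : Ty L.Base} (Φ : Formula L [S]) (Γ : List (Ty L.Base)) : Formula L (S :: Γ) :=
  Φ.rename (liftRen (fun _ x => x.elim) S)

/-- Internal formulae: those in which `st` does not occur. -/
def IsInternal {Γ : List (Ty L.Base)} : Formula L Γ → Prop
  | .falsum | .eq _ _ | .rel _ _ | .mem _ _ => True
  | .st _ => False
  | .and φ ψ | .or φ ψ | .imp φ ψ => φ.IsInternal ∧ ψ.IsInternal
  | .all _ φ | .ex _ φ => φ.IsInternal

/-- `∀ˢᵗ x : S, Φ(x)`. -/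
def allSt {Γ : List (Ty L.Base)} (S : Ty L.Base) (Φ : Formula L (S :: Γ)) : Formula L Γ :=
  .all S (.imp (.st (.var .zero)) Φ)

/-- `∃ˢᵗ x : S, Φ(x)`. -/
def exSt {Γ : List (Ty L.Base)} (S : Ty L.Base) (Φ : Formula L (S :: Γ)) : Formula L Γ :=
  .ex S (.and (.st (.var .zero)) Φ)

/-- `hyper(s)`, i.e. `∀ˢᵗ x : S, x ∈ s`: the sequence `s` is a hyperfinite enumeration of `S`. -/
def hyper {Γ : List (Ty L.Base)} {S : Ty L.Base} (s : Term L Γ (.seq S)) : Formula L Γ :=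
  allSt S (.mem (.var .zero) (s.rename (fun _ x => .succ x)))

/-- `∀ʰʸᵖ s : S*, Φ(s)`. -/
def allHyp {Γ : List (Ty L.Base)} (S : Ty L.Base) (Φ : Formula L (.seq S :: Γ)) : Formula L Γ :=
  .all (.seq S) (.imp (hyper (.var .zero)) Φ)

/-- The universal closure of a formula. -/
def closure : ∀ {Γ : List (Ty L.Base)}, Formula L Γ → Formula L []
  | [], φ => φ
  | S :: _, φ => closure (.all S φ)

end Formula

end Syntax'

/-! ## Interpretation in sets and in the filter topos -/

/-- The set of finite sequences, iterated along the type. -/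
def Ty.interp {B : Type w₁} (X : B → Type u) : Ty B → Type u
  | .base b => X b
  | .seq S => List (S.interp X)

/-- The set of assignments to a context, i.e. the product of the types in it. -/
def Env {B : Type w₁} (X : B → Type u) : List (Ty B) → Type u
  | [] => PUnit
  | S :: Γ => S.interp X × Env X Γ

/-- The value of a variable. -/
def Env.get {B : Type w₁} {X : B → Type u} :
    ∀ {Γ : List (Ty B)} {S : Ty B}, Var Γ S → Env X Γ → S.interp X
  | _, _, .zero, e => e.1
  | _, _, .succ x, e => Env.get x e.2

/-- The assignment with given values. -/
def Env.mk {B : Type w₁} {X : B → Type u} :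
    ∀ {Γ : List (Ty B)}, (∀ S, Var Γ S → S.interp X) → Env X Γ
  | [], _ => PUnit.unit
  | _ :: _, v => (v _ .zero, Env.mk (fun T x => v T (.succ x)))

/-- An interpretation of a language in sets; the type `S*` is interpreted by the set of finite
sequences of elements of `S`. -/
structure Interp (L : Lang.{w₁, w₂, w₃}) where
  carrier : L.Base → Type u
  fn : ∀ {Δ : List (Ty L.Base)} {S : Ty L.Base}, L.Fn Δ S → Env carrier Δ → S.interp carrier
  rel : ∀ {Δ : List (Ty L.Base)}, L.Rel Δ → Set (Env carrier Δ)

section Semantics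

variable {L : Lang.{w₁, w₂, w₃}} (M : Interp.{u} L)

/-- The interpretation of a term as a function. -/
def Term.eval {Γ : List (Ty L.Base)} {S : Ty L.Base} :
    Term L Γ S → Env M.carrier Γ → S.interp M.carrier
  | .var x, e => e.get x
  | .app f args, e => M.fn f (Env.mk fun T x => (args T x).eval e)

/-- The interpretation `⟦Φ⟧` of a formula in context `Γ = S₁, …, Sₙ`, as a subobject of
`𝐲(S₁ × … × Sₙ)` in the filter topos. -/
noncomputable def Formula.interp : ∀ {Γ : List (Ty L.Base)}, Formula L Γ →
    Subfunctor (ySet (Env M.carrier Γ)).obj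
  | _, .falsum => least _
  | _, .eq t t' => equaliser (yFun (t.eval M)) (yFun (t'.eval M))
  | _, .rel R args =>
      (ySub (M.rel R)).preimage (yFun fun e => Env.mk fun T x => (args T x).eval M e).hom
  | _, .mem (S := S) t s =>
      (ySub {p : S.interp M.carrier × List (S.interp M.carrier) | p.1 ∈ p.2}).preimage
        (yFun fun e => (t.eval M e, s.eval M e)).hom
  | _, .st (S := S) t => (delta (S.interp M.carrier)).preimage (yFun (t.eval M)).hom
  | _, .and φ ψ => φ.interp ⊓ ψ.interp
  | _, .or φ ψ => join φ.interp ψ.interp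
  | _, .imp φ ψ => himp φ.interp ψ.interp
  | Γ, .all S φ => forallAlong (yFun (Prod.snd : S.interp M.carrier × Env M.carrier Γ → _)) φ.interp
  | Γ, .ex S φ => existsAlong (yFun (Prod.snd : S.interp M.carrier × Env M.carrier Γ → _)) φ.interp

/-- The interpretation of a formula is a subsheaf, hence a subobject in the topos. -/
theorem Formula.interp_isSheaf {Γ : List (Ty L.Base)} (Φ : Formula L Γ) :
    Presieve.IsSheaf K (Φ.interp M).toFunctor := by
  induction Φ with
  | falsum => exact Subfunctor.sheafify_isSheaf _ (isSheaf_type _)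
  | eq t t' => exact equaliser_isSheaf _ _
  | rel R args => exact preimage_isSheaf _ (ySub_isSheaf _)
  | mem t s => exact preimage_isSheaf _ (ySub_isSheaf _)
  | st t => exact preimage_isSheaf _ (delta_isSheaf _)
  | and φ ψ h1 h2 => exact inf_isSheaf h1 h2
  | or φ ψ h1 h2 => exact Subfunctor.sheafify_isSheaf _ (isSheaf_type _)
  | imp φ ψ h1 h2 => exact himp_isSheaf _ h2
  | all S φ h => exact forallAlong_isSheaf _ h
  | ex S φ h => exact Subfunctor.sheafify_isSheaf _ (isSheaf_type _)

/-- `F ⊩ Φ(α)`: the morphism `α : F ⟶ S₁ × … × Sₙ`, an element of `𝐲(S₁ × … × Sₙ)` at `F`, belongs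
to the subobject `⟦Φ⟧`. -/
def Forces {Γ : List (Ty L.Base)} (F : FSet.{u}) (Φ : Formula L Γ)
    (α : F ⟶ ofSet (Env M.carrier Γ)) : Prop :=
  α ∈ (Φ.interp M).obj (op F)

/-- A sentence holds in the filter topos, `⊩ Φ`, if it is forced at the terminal object `1`. -/
def Holds (Φ : Formula L []) : Prop :=
  Forces M (ofSet PUnit) Φ (𝟙 (ofSet PUnit))

end Semantics

end FilterTopos

open FilterTopos

/-! An internal formula is interpreted by `ySub R` for some set R of assignments
(`Formula.IsInternal.exists_interp_eq`), so forcing it at a germ only says that the values of the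
germ lie in R on some base set.

An existential sentence that holds has witnesses on a finite cover of the terminal object, and some
member G of that cover is proper: if every member had an empty base set, the images of these sets
could not cover the point (`exists_proper_of_holds_ex`). Let x be the witness of Φ at G, and let the
premise `∀ x, Φ → φ` be forced at parameters α over F. Over the product of F and G the pullback of x
still satisfies Φ, since Φ does not mention the parameters, so the pair (x, α) lands in R on a
product of a base set of F with a base set of G. The latter is inhabited, say by w. The constant
x(w) then serves for all points of the base set of F at once (`exists_const_mem_ySub`), and a
constant is standard. No cover of F is needed.

Sequence underspill is the case where Φ is `hyper`. A hyperfinite enumeration exists over the filter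
`enumerations S`: a standard element takes finitely many values, and the generic sequence contains
any prescribed finite set on some base set (`holds_ex_hyper`).

The supporting work is of two kinds: the logical operations on subobjects `ySub R` agree with those
on subsets, and renaming variables is interpreted by inverse image (`Formula.interp_rename`), so
that adding parameters to the context of Φ does not change its meaning. -/

namespace FilterTopos

/-! ## Subobjects of `𝐲S` given by subsets of `S` -/

/-- The composite of a partial map to a set with a function. -/
def ContMap.post {F : FSet.{u}} {S T : Type u} (a : ContMap F (ofSet S)) (f : S → T) :
    ContMap F (ofSet T) where
  dom := a.dom
  toFun v := f (a.toFun v)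
  cont _ := ⟨a.dom, fun _ hv => ⟨hv, trivial⟩⟩

theorem ContMap.post_maps {F : FSet.{u}} {S T : Type u} {a : ContMap F (ofSet S)} {f : S → T}
    {v : F.carrier} {y : T} : (a.post f).Maps v y ↔ ∃ x, a.Maps v x ∧ f x = y := by
  constructor
  · rintro ⟨h, rfl⟩
    exact ⟨_, ⟨h, rfl⟩, rfl⟩
  · rintro ⟨_, ⟨h, rfl⟩, rfl⟩
    exact ⟨h, rfl⟩

theorem germ_comp_ofFun {F : FSet.{u}} {S T : Type u} (a : ContMap F (ofSet S)) (f : S → T) :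
    germ a ≫ ofFun f = germ (a.post f) :=
  (ofFun_maps a f _).2 ⟨a.dom, fun _ hv => ⟨_, ⟨hv, rfl⟩, ⟨hv, rfl⟩⟩⟩

/-- A partial map to `S` with values in `R` on a base set, as a partial map to `R`. -/
theorem exists_lift {F : FSet.{u}} {S : Type u} {R : Set S} {α : F ⟶ ofSet S}
    (h : α ∈ (ySub R).obj (op F)) : ∃ c : F ⟶ ofSet R, c ≫ ofFun Subtype.val = α := h

theorem comp_mem_ySub {F : FSet.{u}} {S : Type u} {R : Set S} (c : F ⟶ ofSet R) :
    c ≫ ofFun Subtype.val ∈ (ySub R).obj (op F) := ⟨c, rfl⟩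

theorem ofFun_comp {S T U : Type u} (f : S → T) (g : T → U) :
    ofFun f ≫ ofFun g = ofFun (g ∘ f) := by
  conv_lhs => lhs; unfold ofFun
  rw [germ_comp_ofFun]
  rfl

theorem yFun_comp {S T U : Type u} (f : S → T) (g : T → U) :
    yFun f ≫ yFun g = yFun (g ∘ f) := by
  rw [← Functor.map_comp, ofFun_comp]

theorem ofFun_mem_ySub {S T : Type u} {f : T → S} {R : Set S} (h : ∀ t, f t ∈ R) :
    (ofFun f : ofSet T ⟶ ofSet S) ∈ (ySub R).obj (op (ofSet T)) := by
  have := comp_mem_ySub (ofFun fun t => (⟨f t, h t⟩ : R))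
  rwa [ofFun_comp] at this

/-- Yoneda: `ySub R` is represented by `ofSet R`, so an inclusion need only be tested on its generic
element, the inclusion map of R. -/
theorem ySub_le_iff {S : Type u} {R : Set S} {C : Subfunctor (ySet S).obj} :
    ySub R ≤ C ↔
      (ofFun Subtype.val : ofSet R ⟶ ofSet S) ∈ C.obj (op (ofSet R)) := by
  constructor
  · exact fun h => h _ (ofFun_mem_ySub fun t => t.2)
  · rintro h ⟨F⟩ α hα
    obtain ⟨c, rfl⟩ := exists_lift hα
    exact C.map c.op h

theorem ySub_mono {S : Type u} {R R' : Set S} (h : R ⊆ R') : ySub R ≤ ySub R' :=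
  ySub_le_iff.2 (ofFun_mem_ySub fun t => h t.2)

theorem ySub_inf {S : Type u} (A B : Set S) : ySub A ⊓ ySub B = ySub (A ∩ B) := by
  refine le_antisymm ?_ (le_inf (ySub_mono Set.inter_subset_left)
    (ySub_mono Set.inter_subset_right))
  rintro ⟨F⟩ α ⟨hA, hB⟩
  obtain ⟨a, rfl⟩ := germ_surj α
  obtain ⟨i, hi⟩ := (mem_ySub A a).1 hA
  obtain ⟨j, hj⟩ := (mem_ySub B a).1 hB
  obtain ⟨k, hk⟩ := F.directed i j
  refine (mem_ySub _ a).2 ⟨k, fun v hv => ?_⟩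
  obtain ⟨x, hx, e⟩ := hi v (hk hv).1
  obtain ⟨y, hy, e'⟩ := hj v (hk hv).2
  obtain rfl := e.unique e'
  exact ⟨x, ⟨hx, hy⟩, e⟩

theorem preimage_ySub {S T : Type u} (f : S → T) (R : Set T) :
    (ySub R).preimage (yFun f).hom = ySub (f ⁻¹' R) := by
  apply le_antisymm
  · rintro ⟨F⟩ α hα
    obtain ⟨a, rfl⟩ := germ_surj α
    replace hα : germ a ≫ ofFun f ∈ (ySub R).obj (op F) := hα
    rw [germ_comp_ofFun] at hα
    obtain ⟨i, hi⟩ := (mem_ySub R _).1 hα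
    refine (mem_ySub _ a).2 ⟨i, fun v hv => ?_⟩
    obtain ⟨y, hy, e⟩ := hi v hv
    obtain ⟨x, hx, rfl⟩ := ContMap.post_maps.1 e
    exact ⟨x, hy, hx⟩
  · refine ySub_le_iff.2 ?_
    change ofFun Subtype.val ≫ ofFun f ∈ (ySub R).obj _
    rw [ofFun_comp]
    exact ofFun_mem_ySub fun t => t.2

/-- The empty family covers the filter `ofSet ∅`, so the sheafified bottom contains the generic
element of the empty subset. -/
theorem least_eq_ySub (S : Type u) : least (ySet S) = ySub ∅ := by
  apply le_antisymm
  · exact Subfunctor.sheafify_le _ _ bot_le (isSheaf_type _) (ySub_isSheaf _)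
  · refine ySub_le_iff.2 ?_
    refine ⟨PEmpty, inferInstance, PEmpty.elim, fun k => k.elim, fun k => k.elim, ?_⟩
    exact fun _ _ _ => ⟨⟨⟩, fun v => v.2.elim⟩

theorem equaliser_yFun {S T : Type u} (f g : S → T) :
    equaliser (yFun f) (yFun g) = ySub {s | f s = g s} := by
  apply le_antisymm
  · rintro ⟨F⟩ α hα
    obtain ⟨a, rfl⟩ := germ_surj α
    replace hα : germ a ≫ ofFun f = germ a ≫ ofFun g := hα
    rw [germ_comp_ofFun, germ_comp_ofFun, germ_eq_iff] at hα
    obtain ⟨i, hi⟩ := hα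
    refine (mem_ySub _ a).2 ⟨i, fun v hv => ?_⟩
    obtain ⟨y, h1, h2⟩ := hi v hv
    obtain ⟨x, hx, rfl⟩ := ContMap.post_maps.1 h1
    obtain ⟨x', hx', e⟩ := ContMap.post_maps.1 h2
    obtain rfl := hx.unique hx'
    exact ⟨x, e.symm, hx⟩
  · refine ySub_le_iff.2 ?_
    change ofFun Subtype.val ≫ ofFun f = ofFun Subtype.val ≫ ofFun g
    rw [ofFun_comp, ofFun_comp]
    exact congrArg ofFun (funext fun t => t.2)

/-- The union is covered by the inclusions of A and B. Restricted to either piece, its generic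
element already lies in the pointwise join. -/
theorem join_ySub {S : Type u} (A B : Set S) : join (ySub A) (ySub B) = ySub (A ∪ B) := by
  apply le_antisymm
  · exact Subfunctor.sheafify_le _ _ (sup_le (ySub_mono Set.subset_union_left)
      (ySub_mono Set.subset_union_right)) (isSheaf_type _) (ySub_isSheaf _)
  · refine ySub_le_iff.2 ?_
    let P : Bool → Set S := fun k => bif k then A else B
    have hP : ∀ k, P k ⊆ A ∪ B
      | true => Set.subset_union_left
      | false => Set.subset_union_right
    refine ⟨Bool, inferInstance, fun k => ofSet (P k), fun k => ofFun (Set.inclusion (hP k)),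
      fun k => ?_, covers_of_rep _ fun _ => ⟨⟨⟩, ?_⟩⟩
    · have h : (ofFun Subtype.val : ofSet (P k) ⟶ ofSet S) ∈ (ySub (P k)).obj _ :=
        ofFun_mem_ySub fun t => t.2
      change ofFun (Set.inclusion (hP k)) ≫ ofFun Subtype.val ∈ (ySub A ⊔ ySub B).obj _
      rw [ofFun_comp]
      cases k
      · exact Or.inr h
      · exact Or.inl h
    · rintro ⟨v, hv⟩ -
      rcases hv with hv | hv
      · exact ⟨true, ⟨v, hv⟩, trivial, trivial, rfl⟩
      · exact ⟨false, ⟨v, hv⟩, trivial, trivial, rfl⟩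

/-- A choice of preimages lifts the generic element of the image globally, so it lies in the
pointwise image before sheafifying. -/
theorem existsAlong_ySub {S T : Type u} (f : S → T) (R : Set S) :
    existsAlong (yFun f) (ySub R) = ySub (f '' R) := by
  apply le_antisymm
  · refine Subfunctor.sheafify_le _ _ ?_ (isSheaf_type _) (ySub_isSheaf _)
    rw [Subfunctor.image_le_iff, preimage_ySub]
    exact ySub_mono (Set.subset_preimage_image f R)
  · refine le_trans (ySub_le_iff.2 ?_) (Subfunctor.le_sheafify K _)
    choose g hg hg' using fun t : f '' R => t.2
    refine ⟨ofFun g, ofFun_mem_ySub hg, ?_⟩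
    change ofFun g ≫ ofFun f = _
    rw [ofFun_comp]
    exact congrArg ofFun (funext hg')

/-- For the forward inclusion, the hypothesis is tested at the generic point of a fibre, namely the
second projection of the fibre product of F and S over T. Since S has itself as its only base set,
this tests every point of the fibre over each value of the germ. -/
theorem forallAlong_ySub {S T : Type u} (f : S → T) (R : Set S) :
    forallAlong (yFun f) (ySub R) = ySub {t | ∀ s, f s = t → s ∈ R} := by
  apply le_antisymm
  · rintro ⟨F⟩ α hα
    obtain ⟨a, rfl⟩ := germ_surj α
    let c : ContMap (ofSet S) (ofSet T) :=
      ⟨⟨⟩, fun x => f x.1, fun _ => ⟨⟨⟩, fun _ _ => ⟨trivial, trivial⟩⟩⟩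
    have h : germ (pbSnd a c) ∈ (ySub R).obj (op (pb a c)) :=
      hα (germ (pbFst a c)).op (germ (pbSnd a c)) (pb_comm a c).symm
    obtain ⟨p, hp⟩ := (mem_ySub R _).1 h
    obtain ⟨k, hk⟩ := F.directed p.1 a.dom
    refine (mem_ySub _ a).2 ⟨k, fun v hv => ⟨_, ?_, (hk hv).2, rfl⟩⟩
    intro s hs
    obtain ⟨x, hx, _, e⟩ := hp (v, s) ⟨(hk hv).1, trivial, _, ⟨(hk hv).2, rfl⟩, trivial, hs⟩
    obtain rfl : s = x := e
    exact hx
  · rw [le_forallAlong_iff, preimage_ySub]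
    exact ySub_mono fun s hs => hs s rfl

/-- Implication from A lies below universal quantification along the inclusion of A, which reduces
the forward inclusion to `forallAlong_ySub`. Excluded middle for membership in A then gives the form
with the complement. -/
theorem himp_ySub {S : Type u} (A B : Set S) : himp (ySub A) (ySub B) = ySub (Aᶜ ∪ B) := by
  apply le_antisymm
  · have h : himp (ySub A) (ySub B) ≤ forallAlong (yFun (Subtype.val : A → S))
        ((ySub B).preimage (yFun (Subtype.val : A → S)).hom) := by
      rw [le_forallAlong_iff]
      intro U x hx
      have := hx (𝟙 U)
      simp only [Functor.map_id_apply] at this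
      exact this ⟨x, rfl⟩
    rw [preimage_ySub, forallAlong_ySub] at h
    refine h.trans (ySub_mono fun t ht => ?_)
    by_cases hA : t ∈ A
    · exact Or.inr (ht ⟨t, hA⟩ rfl)
    · exact Or.inl hA
  · rw [le_himp_iff, ySub_inf]
    exact ySub_mono fun t ht => ht.1.resolve_left fun h => h ht.2

/-- Internal formulae are interpreted by subsets. -/
theorem Formula.IsInternal.exists_interp_eq {L : Lang.{w₁, w₂, w₃}} (M : Interp.{u} L)
    {Γ : List (Ty L.Base)} {φ : Formula L Γ} (h : φ.IsInternal) :
    ∃ R : Set (Env M.carrier Γ), φ.interp M = ySub R := by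
  induction φ with
  | falsum => exact ⟨_, least_eq_ySub _⟩
  | eq t t' => exact ⟨_, equaliser_yFun _ _⟩
  | rel R args => exact ⟨_, preimage_ySub _ _⟩
  | mem t s => exact ⟨_, preimage_ySub _ _⟩
  | st t => exact h.elim
  | and φ ψ h1 h2 =>
    obtain ⟨A, hA⟩ := h1 h.1
    obtain ⟨B, hB⟩ := h2 h.2
    exact ⟨_, by rw [Formula.interp, hA, hB, ySub_inf]⟩
  | or φ ψ h1 h2 =>
    obtain ⟨A, hA⟩ := h1 h.1
    obtain ⟨B, hB⟩ := h2 h.2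
    exact ⟨_, by rw [Formula.interp, hA, hB, join_ySub]⟩
  | imp φ ψ h1 h2 =>
    obtain ⟨A, hA⟩ := h1 h.1
    obtain ⟨B, hB⟩ := h2 h.2
    exact ⟨_, by rw [Formula.interp, hA, hB, himp_ySub]⟩
  | all S φ h1 =>
    obtain ⟨A, hA⟩ := h1 h
    exact ⟨_, by rw [Formula.interp, hA]; exact forallAlong_ySub _ _⟩
  | ex S φ h1 =>
    obtain ⟨A, hA⟩ := h1 h
    exact ⟨_, by rw [Formula.interp, hA]; exact existsAlong_ySub _ _⟩

/-! ## Inverse images and the operations on subobjects -/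

/-- Naturality makes the two sieves that decide membership equal. -/
theorem sheafify_preimage {X Y : NTopos.{u}} (p : X ⟶ Y) (A : Subfunctor Y.obj) :
    (A.sheafify K).preimage p.hom = (A.preimage p.hom).sheafify K := by
  ext U s
  have h : A.sieveOfSection (p.hom.app U s) = (A.preimage p.hom).sieveOfSection s := by
    ext V f
    change Y.obj.map f.op (p.hom.app U s) ∈ A.obj _ ↔ p.hom.app _ (X.obj.map f.op s) ∈ A.obj _
    rw [NatTrans.naturality_apply]
  change _ ∈ K _ ↔ _ ∈ K _
  rw [h]

theorem himp_preimage {X Y : NTopos.{u}} (p : X ⟶ Y) (A B : Subfunctor Y.obj) :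
    (himp A B).preimage p.hom = himp (A.preimage p.hom) (B.preimage p.hom) := by
  ext U s
  change (∀ ⦃V⦄ (f : U ⟶ V), Y.obj.map f (p.hom.app U s) ∈ A.obj V →
      Y.obj.map f (p.hom.app U s) ∈ B.obj V) ↔
    ∀ ⦃V⦄ (f : U ⟶ V), p.hom.app V (X.obj.map f s) ∈ A.obj V →
      p.hom.app V (X.obj.map f s) ∈ B.obj V
  simp only [NatTrans.naturality_apply]

/-- The fibres of `p'` map onto the fibres of `p`. -/
structure IsWeakPullback {X' X Y' Y : NTopos.{u}} (q : X' ⟶ X) (p' : X' ⟶ Y') (p : X ⟶ Y)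
    (r : Y' ⟶ Y) : Prop where
  comm : ∀ U (x' : X'.obj.obj U), p.hom.app U (q.hom.app U x') = r.hom.app U (p'.hom.app U x')
  lift : ∀ U (x : X.obj.obj U) (y' : Y'.obj.obj U), p.hom.app U x = r.hom.app U y' →
    ∃ x', p'.hom.app U x' = y' ∧ q.hom.app U x' = x

/-- Beck–Chevalley. Quantification along a map only asks which elements occur in its fibres, so
surjectivity on fibres suffices and uniqueness of lifts plays no role. -/
theorem IsWeakPullback.forallAlong_preimage {X' X Y' Y : NTopos.{u}} {q : X' ⟶ X} {p' : X' ⟶ Y'}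
    {p : X ⟶ Y} {r : Y' ⟶ Y} (h : IsWeakPullback q p' p r) (A : Subfunctor X.obj) :
    (forallAlong p A).preimage r.hom = forallAlong p' (A.preimage q.hom) := by
  ext U s
  constructor
  · intro hs V f x hx
    refine hs f (q.hom.app V x) ?_
    rw [h.comm, hx, NatTrans.naturality_apply]
  · intro hs V f x hx
    rw [← NatTrans.naturality_apply] at hx
    obtain ⟨x', h1, rfl⟩ := h.lift V x _ hx
    exact hs f x' h1

theorem IsWeakPullback.existsAlong_preimage {X' X Y' Y : NTopos.{u}} {q : X' ⟶ X} {p' : X' ⟶ Y'}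
    {p : X ⟶ Y} {r : Y' ⟶ Y} (h : IsWeakPullback q p' p r) (A : Subfunctor X.obj) :
    (existsAlong p A).preimage r.hom = existsAlong p' (A.preimage q.hom) := by
  rw [existsAlong, existsAlong, sheafify_preimage]
  congr 1
  ext U s
  constructor
  · rintro ⟨x, hx, e⟩
    obtain ⟨x', h1, rfl⟩ := h.lift U x s e
    exact ⟨x', hx, h1⟩
  · rintro ⟨x', hx', rfl⟩
    exact ⟨q.hom.app U x', hx', h.comm U x'⟩

/-! ## Pairs of germs -/

/-- Directedness supplies a base set on which both germs are defined. With `pair_ext`, this says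
that the embedding of sets preserves binary products. -/
theorem exists_pair {F : FSet.{u}} {S T : Type u} (α : F ⟶ ofSet S) (β : F ⟶ ofSet T) :
    ∃ γ : F ⟶ ofSet (S × T), γ ≫ ofFun Prod.fst = α ∧ γ ≫ ofFun Prod.snd = β := by
  obtain ⟨a, rfl⟩ := germ_surj α
  obtain ⟨b, rfl⟩ := germ_surj β
  obtain ⟨k, hk⟩ := F.directed a.dom b.dom
  let c : ContMap F (ofSet (S × T)) :=
    ⟨k, fun v => (a.toFun ⟨v, (hk v.2).1⟩, b.toFun ⟨v, (hk v.2).2⟩),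
      fun _ => ⟨k, fun _ hv => ⟨hv, trivial⟩⟩⟩
  exact ⟨germ c, (ofFun_maps _ _ _).2 ⟨k, fun v hv => ⟨_, ⟨hv, rfl⟩, ⟨(hk hv).1, rfl⟩⟩⟩,
    (ofFun_maps _ _ _).2 ⟨k, fun v hv => ⟨_, ⟨hv, rfl⟩, ⟨(hk hv).2, rfl⟩⟩⟩⟩

theorem pair_ext {F : FSet.{u}} {S T : Type u} {γ δ : F ⟶ ofSet (S × T)}
    (h1 : γ ≫ ofFun Prod.fst = δ ≫ ofFun Prod.fst)
    (h2 : γ ≫ ofFun Prod.snd = δ ≫ ofFun Prod.snd) : γ = δ := by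
  obtain ⟨c, rfl⟩ := germ_surj γ
  obtain ⟨d, rfl⟩ := germ_surj δ
  rw [germ_comp_ofFun, germ_comp_ofFun, germ_eq_iff] at h1 h2
  obtain ⟨i, hi⟩ := h1
  obtain ⟨j, hj⟩ := h2
  obtain ⟨k, hk⟩ := F.directed i j
  refine germ_eq_iff.2 ⟨k, fun v hv => ?_⟩
  obtain ⟨s, h1, h2⟩ := hi v (hk hv).1
  obtain ⟨t, h3, h4⟩ := hj v (hk hv).2
  obtain ⟨x, hx, e1⟩ := ContMap.post_maps.1 h1
  obtain ⟨y, hy, e2⟩ := ContMap.post_maps.1 h2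
  obtain ⟨x', hx', e3⟩ := ContMap.post_maps.1 h3
  obtain ⟨y', hy', e4⟩ := ContMap.post_maps.1 h4
  obtain rfl := hx.unique hx'
  obtain rfl := hy.unique hy'
  obtain rfl : x = y := Prod.ext (e1.trans e2.symm) (e3.trans e4.symm)
  exact ⟨x, hx, hy⟩

/-- The square of projections along which a renaming passes under a quantifier. The lift pairs the
S-component of `x` with `y`. -/
theorem isWeakPullback_prod (S : Type u) {T T' : Type u} (f : T' → T) :
    IsWeakPullback (yFun fun z : S × T' => (z.1, f z.2)) (yFun Prod.snd)
      (yFun (Prod.snd : S × T → T)) (yFun f) where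
  comm := by
    rintro ⟨F⟩ (x : F ⟶ _)
    change (x ≫ ofFun _) ≫ ofFun _ = (x ≫ ofFun _) ≫ ofFun _
    rw [Category.assoc, Category.assoc, ofFun_comp, ofFun_comp]
    rfl
  lift := by
    rintro ⟨F⟩ (x : F ⟶ _) (y : F ⟶ _) h
    replace h : x ≫ ofFun Prod.snd = y ≫ ofFun f := h
    obtain ⟨γ, h1, h2⟩ := exists_pair (x ≫ ofFun Prod.fst) y
    refine ⟨γ, h2, pair_ext ?_ ?_⟩
    · rw [← h1]
      change (γ ≫ ofFun _) ≫ ofFun _ = _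
      rw [Category.assoc, ofFun_comp]
      rfl
    · rw [h, ← h2]
      change (γ ≫ ofFun _) ≫ ofFun _ = _
      rw [Category.assoc, Category.assoc, ofFun_comp, ofFun_comp]
      rfl

/-! ## Renaming of variables -/

/-- The action of a renaming on assignments. -/
def Env.ren {B : Type w₁} (X : B → Type u) {Γ Δ : List (Ty B)} (r : ∀ T, Var Γ T → Var Δ T)
    (e : Env X Δ) : Env X Γ := Env.mk fun T x => e.get (r T x)

theorem Env.get_mk {B : Type w₁} {X : B → Type u} {Γ : List (Ty B)}
    (v : ∀ S, Var Γ S → S.interp X) {S : Ty B} (x : Var Γ S) : (Env.mk v).get x = v S x := by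
  induction x with
  | zero => rfl
  | succ x ih => exact ih _

section

variable {L : Lang.{w₁, w₂, w₃}} (M : Interp.{u} L)

theorem Term.eval_rename {Γ Δ : List (Ty L.Base)} (r : ∀ T, Var Γ T → Var Δ T) {S : Ty L.Base}
    (t : Term L Γ S) (e : Env M.carrier Δ) :
    (t.rename r).eval M e = t.eval M (Env.ren M.carrier r e) := by
  induction t with
  | var x => exact (Env.get_mk (fun T x => e.get (r T x)) x).symm
  | app f args ih =>
    change M.fn f _ = M.fn f _
    congr 2
    funext T x
    exact ih T x

theorem preimage_yFun_comp {S T U : Type u} (f : S → T) (g : T → U) (A : Subfunctor (ySet U).obj) :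
    (A.preimage (yFun g).hom).preimage (yFun f).hom = A.preimage (yFun (g ∘ f)).hom := by
  rw [← Subfunctor.preimage_comp, ← yFun_comp]
  rfl

/-- The substitution lemma. Inverse image commutes with each operation used in the interpretation;
the quantifier cases are Beck–Chevalley for `isWeakPullback_prod`. External formulae must be
included, because the lemma applies to `Φ.weaken Γ`. -/
theorem Formula.interp_rename {Γ Δ : List (Ty L.Base)} (r : ∀ T, Var Γ T → Var Δ T)
    (Φ : Formula L Γ) :
    (Φ.rename r).interp M = (Φ.interp M).preimage (yFun (Env.ren M.carrier r)).hom := by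
  induction Φ generalizing Δ with
  | falsum =>
    change least _ = (least _).preimage _
    rw [least_eq_ySub, least_eq_ySub, preimage_ySub]
    rfl
  | eq t t' =>
    change equaliser _ _ = (equaliser _ _).preimage _
    simp only [equaliser_yFun, preimage_ySub, Term.eval_rename]
    rfl
  | rel R args =>
    rw [Formula.rename, Formula.interp, Formula.interp, preimage_yFun_comp]
    refine congrArg (fun f => (ySub (M.rel R)).preimage (yFun f).hom) (funext fun e => ?_)
    exact congrArg Env.mk (funext fun T => funext fun x => (args T x).eval_rename M r e)
  | mem t s =>
    refine Eq.trans ?_ (preimage_yFun_comp (Env.ren M.carrier r)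
      (U := _ × List (Ty.interp M.carrier _))
      (fun e => (t.eval M e, s.eval M e)) (ySub {p | p.1 ∈ p.2})).symm
    exact congrArg (fun f => (ySub _).preimage (yFun f).hom) (funext fun e =>
      congrArg₂ Prod.mk (t.eval_rename M r e) (s.eval_rename M r e))
  | st t =>
    rw [Formula.rename, Formula.interp, Formula.interp, preimage_yFun_comp]
    exact congrArg (fun f => (delta _).preimage (yFun f).hom) (funext (t.eval_rename M r))
  | and φ ψ h1 h2 =>
    rw [Formula.rename, Formula.interp, Formula.interp, h1, h2]
    rfl
  | or φ ψ h1 h2 =>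
    rw [Formula.rename, Formula.interp, Formula.interp, h1, h2, join, join, sheafify_preimage]
    rfl
  | imp φ ψ h1 h2 =>
    rw [Formula.rename, Formula.interp, Formula.interp, h1, h2, himp_preimage]
  | all S φ h =>
    rw [Formula.rename, Formula.interp, h]
    exact ((isWeakPullback_prod (S.interp M.carrier)
      (Env.ren M.carrier r)).forallAlong_preimage (φ.interp M)).symm
  | ex S φ h =>
    rw [Formula.rename, Formula.interp, h]
    exact ((isWeakPullback_prod (S.interp M.carrier)
      (Env.ren M.carrier r)).existsAlong_preimage (φ.interp M)).symm

end

/-! ## Forcing -/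

theorem ofFun_id (S : Type u) : ofFun (fun s : S => s) = 𝟙 (ofSet S) :=
  germ_eq_iff.2 ⟨⟨⟩, fun v _ => ⟨v, ⟨trivial, rfl⟩, ⟨trivial, rfl⟩⟩⟩

/-- Forgetting all parameters leaves only the first component. This is how an assignment for
`Φ.weaken Γ` is recognised as a restriction of the original witness of Φ. -/
theorem comp_pair_unit {F G : FSet.{u}} {S T : Type u} {γ : F ⟶ ofSet (S × T)} {g : F ⟶ G}
    {x : G ⟶ ofSet (S × PUnit.{u + 1})} (h : γ ≫ ofFun Prod.fst = g ≫ x ≫ ofFun Prod.fst) :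
    γ ≫ ofFun (fun e => (e.1, PUnit.unit)) = g ≫ x := by
  have e1 : ofFun (fun e : S × T => (e.1, PUnit.unit.{u + 1})) =
      ofFun Prod.fst ≫ ofFun (fun s => (s, PUnit.unit)) := by
    rw [ofFun_comp]
    rfl
  have e2 : ofFun (Prod.fst : S × PUnit.{u + 1} → S) ≫ ofFun (fun s => (s, PUnit.unit)) = 𝟙 _ := by
    rw [ofFun_comp]
    exact ofFun_id _
  rw [e1, ← Category.assoc, h, Category.assoc, Category.assoc, e2, Category.comp_id]

section

variable {L : Lang.{w₁, w₂, w₃}} {M : Interp.{u} L} {Γ : List (Ty L.Base)}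

theorem forces_imp {F : FSet.{u}} {φ ψ : Formula L Γ} {α : F ⟶ ofSet (Env M.carrier Γ)} :
    Forces M F (.imp φ ψ) α ↔
      ∀ (G : FSet.{u}) (f : G ⟶ F), Forces M G φ (f ≫ α) → Forces M G ψ (f ≫ α) :=
  ⟨fun h _ f => h f.op, fun h _ f => h _ f.unop⟩

theorem Forces.mp {F : FSet.{u}} {φ ψ : Formula L Γ} {α : F ⟶ ofSet (Env M.carrier Γ)}
    (h : Forces M F (.imp φ ψ) α) (hφ : Forces M F φ α) : Forces M F ψ α := by
  have := forces_imp.1 h F (𝟙 F)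
  rw [Category.id_comp] at this
  exact this hφ

theorem forces_all {F : FSet.{u}} {S : Ty L.Base} {φ : Formula L (S :: Γ)}
    {α : F ⟶ ofSet (Env M.carrier Γ)} :
    Forces M F (.all S φ) α ↔ ∀ (G : FSet.{u}) (f : G ⟶ F)
      (x : G ⟶ ofSet (S.interp M.carrier × Env M.carrier Γ)),
      x ≫ ofFun Prod.snd = f ≫ α → Forces M G φ x :=
  ⟨fun h _ f => h f.op, fun h _ f => h _ f.unop⟩

/-- Membership in the sheafified image means that the sieve of local witnesses is covering, which
unfolds to a finite covering family. -/
theorem forces_ex {F : FSet.{u}} {S : Ty L.Base} {φ : Formula L (S :: Γ)}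
    {α : F ⟶ ofSet (Env M.carrier Γ)} :
    Forces M F (.ex S φ) α ↔ ∃ (ι : Type) (_ : Finite ι) (G : ι → FSet.{u}) (β : ∀ k, G k ⟶ F),
      (∀ k, ∃ x : G k ⟶ ofSet (S.interp M.carrier × Env M.carrier Γ),
        Forces M (G k) φ x ∧ x ≫ ofFun Prod.snd = β k ≫ α) ∧ Covers G β :=
  Iff.rfl

theorem Forces.ex_intro {F : FSet.{u}} {S : Ty L.Base} {φ : Formula L (S :: Γ)}
    {x : F ⟶ ofSet (S.interp M.carrier × Env M.carrier Γ)} (h : Forces M F φ x)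
    {α : F ⟶ ofSet (Env M.carrier Γ)} (e : x ≫ ofFun Prod.snd = α) : Forces M F (.ex S φ) α :=
  Subfunctor.le_sheafify K _ _ ⟨x, h, e⟩

theorem Forces.map {F G : FSet.{u}} {φ : Formula L Γ} {α : F ⟶ ofSet (Env M.carrier Γ)}
    (h : Forces M F φ α) (f : G ⟶ F) : Forces M G φ (f ≫ α) :=
  (φ.interp M).map f.op h

theorem forces_rename {Δ : List (Ty L.Base)} {F : FSet.{u}} (r : ∀ T, Var Γ T → Var Δ T)
    (φ : Formula L Γ) {α : F ⟶ ofSet (Env M.carrier Δ)} :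
    Forces M F (φ.rename r) α ↔ Forces M F φ (α ≫ ofFun (Env.ren M.carrier r)) := by
  rw [Forces, Formula.interp_rename]
  rfl

theorem holds_closure {φ : Formula L Γ} (h : ∀ F α, Forces M F φ α) :
    Holds M (Formula.closure φ) := by
  induction Γ with
  | nil => exact h _ _
  | cons S Γ ih => exact ih fun F α => forces_all.2 fun G f x _ => h G x

/-- An existential sentence that holds has a witness at a proper filter. -/
theorem exists_proper_of_holds_ex {S : Ty L.Base} {Φ : Formula L [S]} (h : Holds M (.ex S Φ)) :
    ∃ G : FSet.{u}, (∀ j, (G.base j).Nonempty) ∧ ∃ x, Forces M G Φ x := by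
  obtain ⟨ι, -, G, β, hx, hβ⟩ := forces_ex.1 h
  by_contra! hne
  have hempty : ∀ k, ∃ j, (G k).base j = ∅ := by
    intro k
    by_contra! hk
    obtain ⟨x, hx, -⟩ := hx k
    exact hne (G k) hk x hx
  -- The covering condition allows any choice of base sets, in particular the empty ones; their
  -- images would have to contain the point of the terminal object.
  choose j hj using hempty
  choose b hb using fun k => germ_surj (β k)
  obtain ⟨i, hi⟩ := hβ b hb j
  obtain ⟨k, w, hw, -⟩ := hi PUnit.unit trivial
  rw [hj k] at hw
  exact hw

end

/-! ### From a witness over a proper filter to a constant witness -/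

/-- If a relation holds between the values of an element `x` at a proper filter `G` and of an
element `a` at `F`, over the product of `F` and `G`, then it holds between some fixed value of `x`
and the values of `a`. -/
theorem exists_const_mem_ySub {F G : FSet.{u}} (hG : ∀ j, (G.base j).Nonempty) {S T : Type u}
    (x : G ⟶ ofSet S) (α : F ⟶ ofSet T) (R : Set (S × T))
    (h : ∀ (H : FSet.{u}) (g : H ⟶ G) (f : H ⟶ F) (γ : H ⟶ ofSet (S × T)),
      γ ≫ ofFun Prod.fst = g ≫ x → γ ≫ ofFun Prod.snd = f ≫ α → γ ∈ (ySub R).obj (op H)) :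
    ∃ s, α ≫ ofFun (fun t => (s, t)) ∈ (ySub R).obj (op F) := by
  obtain ⟨x, rfl⟩ := germ_surj x
  obtain ⟨a, rfl⟩ := germ_surj α
  -- Over a one-point set the matching condition is only that both maps be defined, so this fibre
  -- product is the product of F and G.
  let a' : ContMap F (ofSet PUnit) := a.post fun _ => ⟨⟩
  let x' : ContMap G (ofSet PUnit) := x.post fun _ => ⟨⟩
  let c : ContMap (pb a' x') (ofSet (S × T)) :=
    ⟨(a.dom, x.dom), fun v => (x.toFun ⟨v.1.2, v.2.2.1⟩, a.toFun ⟨v.1.1, v.2.1⟩),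
      fun _ => ⟨_, fun _ hv => ⟨hv, trivial⟩⟩⟩
  obtain ⟨k, hk⟩ := pb_maps a' x'
  have hc : germ c ∈ (ySub R).obj (op (pb a' x')) := by
    refine h _ (germ (pbSnd a' x')) (germ (pbFst a' x')) _ ?_ ?_
    · rw [germ_comp, ofFun_maps]
      obtain ⟨l, hl⟩ := (pbSnd a' x').comp_maps x
      obtain ⟨m, hm⟩ := (pb a' x').directed k l
      obtain ⟨n, hn⟩ := (pb a' x').directed m c.dom
      refine ⟨n, fun v hv => ⟨_, ⟨(hn hv).2, rfl⟩, ?_⟩⟩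
      obtain ⟨d, e, h1, h2, h3⟩ := hl v (hm (hn hv).1).2
      obtain rfl := h1.unique (hk v (hm (hn hv).1).1).2.1
      obtain ⟨_, rfl⟩ := h2
      exact h3
    · rw [germ_comp, ofFun_maps]
      obtain ⟨l, hl⟩ := (pbFst a' x').comp_maps a
      obtain ⟨m, hm⟩ := (pb a' x').directed k l
      obtain ⟨n, hn⟩ := (pb a' x').directed m c.dom
      refine ⟨n, fun v hv => ⟨_, ⟨(hn hv).2, rfl⟩, ?_⟩⟩
      obtain ⟨d, e, h1, h2, h3⟩ := hl v (hm (hn hv).1).2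
      obtain rfl := h1.unique (hk v (hm (hn hv).1).1).1
      obtain ⟨_, rfl⟩ := h2
      exact h3
  obtain ⟨p, hp⟩ := (mem_ySub R c).1 hc
  -- The relation holds on the product of the base sets `p.1` and `p.2`. Properness of G provides
  -- one point `w` at which `x` is defined, fixed independently of the point of F.
  obtain ⟨j, hj⟩ := G.directed p.2 x.dom
  obtain ⟨w, hw⟩ := hG j
  refine ⟨x.toFun ⟨w, (hj hw).2⟩, ?_⟩
  rw [germ_comp_ofFun, mem_ySub]
  obtain ⟨i, hi⟩ := F.directed p.1 a.dom
  refine ⟨i, fun v hv => ?_⟩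
  obtain ⟨_, hr, _, rfl⟩ := hp (v, w) ⟨(hi hv).1, (hj hw).1, ⟨⟩, ⟨(hi hv).2, rfl⟩, (hj hw).2, rfl⟩
  exact ⟨_, hr, (hi hv).2, rfl⟩

section

variable {L : Lang.{w₁, w₂, w₃}} {M : Interp.{u} L}

/-- Constant elements are standard. -/
theorem comp_const_mem_delta {F : FSet.{u}} {S T : Type u} (α : F ⟶ ofSet T) (s : S) :
    α ≫ ofFun (fun _ => s) ∈ (delta S).obj (op F) := by
  obtain ⟨a, rfl⟩ := germ_surj α
  rw [germ_comp_ofFun]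
  exact ⟨_, rfl, (Set.finite_singleton s).subset (Set.range_subset_iff.2 fun _ => rfl)⟩

/-- The witness of Φ, possibly nonstandard, is moved to products with F, where the premise turns it
into a witness of φ. Because φ is a subset condition, fixing the G-coordinate replaces that witness
by a constant. -/
theorem holds_exSt_of_holds_ex {S : Ty L.Base} {Φ : Formula L [S]} (h : Holds M (.ex S Φ))
    {Γ : List (Ty L.Base)} {φ : Formula L (S :: Γ)} (hφ : φ.IsInternal) :
    Holds M (Formula.closure (.imp (.all S (.imp (Φ.weaken Γ) φ)) (.exSt S φ))) := by
  obtain ⟨G, hG, x, hx⟩ := exists_proper_of_holds_ex h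
  obtain ⟨R, hR⟩ := hφ.exists_interp_eq M
  refine holds_closure fun F₀ α₀ => forces_imp.2 fun F f hall => ?_
  generalize f ≫ α₀ = α at hall ⊢
  -- Over any H mapping to both G and F, Φ persists along the map to G, and `comp_pair_unit` shows
  -- that the parameters do not affect it; the premise over F then yields φ.
  have key : ∀ (H : FSet.{u}) (g : H ⟶ G) (f : H ⟶ F)
      (γ : H ⟶ ofSet (S.interp M.carrier × Env M.carrier Γ)),
      γ ≫ ofFun Prod.fst = g ≫ x ≫ ofFun (Prod.fst : _ × PUnit → _) →
      γ ≫ ofFun Prod.snd = f ≫ α → γ ∈ (ySub R).obj (op H) := by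
    intro H g f γ h1 h2
    rw [← hR]
    refine (forces_all.1 hall H f γ h2).mp ((forces_rename _ _).2 ?_)
    have e : γ ≫ ofFun (Env.ren M.carrier (liftRen (fun _ (x : Var [] _) => x.elim) S)) =
        g ≫ x := comp_pair_unit h1
    exact e ▸ hx.map g
  obtain ⟨s, hs⟩ := exists_const_mem_ySub hG _ α R key
  have hst : Forces M F (.and (.st (.var .zero)) φ) (α ≫ ofFun fun e => (s, e)) := by
    refine ⟨?_, ?_⟩
    · change (α ≫ ofFun fun e => (s, e)) ≫
        ofFun (Prod.fst : S.interp M.carrier × Env M.carrier Γ → _) ∈ (delta _).obj _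
      rw [Category.assoc, ofFun_comp]
      exact comp_const_mem_delta α s
    · rw [hR]
      exact hs
  have e : (α ≫ ofFun fun e => (s, e)) ≫ ofFun Prod.snd = α := by
    rw [Category.assoc, ofFun_comp]
    exact (congrArg _ (ofFun_id _)).trans (Category.comp_id α)
  exact hst.ex_intro e

/-! ## Hyperfinite enumerations -/

/-- The filter of the finite sequences that enumerate a given finite subset of `S`. -/
def enumerations (S : Type u) : FSet.{u} where
  carrier := List S
  Index := Finset S
  base A := {s | ∀ x ∈ A, x ∈ s}
  nonempty := ⟨∅⟩
  directed A B := by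
    classical
    exact ⟨A ∪ B, fun s hs => ⟨fun x hx => hs x (Finset.mem_union_left _ hx),
      fun x hx => hs x (Finset.mem_union_right _ hx)⟩⟩

theorem enumerations_nonempty {S : Type u} (A : Finset S) :
    ((enumerations S).base A).Nonempty := ⟨A.toList, fun _ hx => Finset.mem_toList.2 hx⟩

/-- The generic sequence, as an assignment to a single variable. -/
def genericSeq (S : Type u) : ContMap (enumerations S) (ofSet (List S × PUnit.{u + 1})) where
  dom := (∅ : Finset S)
  toFun v := (v.1, ⟨⟩)
  cont _ := ⟨(∅ : Finset S), fun _ hv => ⟨hv, trivial⟩⟩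

/-- A standard element has its values in a finite set A on some base set. Continuity of `f` at the
base set of sequences enumerating A makes the sequence contain all of A on a smaller one. -/
theorem mem_genericSeq {S : Type u} {H : FSet.{u}}
    {z : H ⟶ ofSet (S × (List S × PUnit.{u + 1}))} {f : H ⟶ enumerations S}
    (hz : z ≫ ofFun Prod.snd = f ≫ germ (genericSeq S))
    (hst : z ≫ ofFun Prod.fst ∈ (delta S).obj (op H)) :
    z ≫ ofFun (fun e => (e.1, e.2.1)) ∈ (ySub {p : S × List S | p.1 ∈ p.2}).obj (op H) := by
  obtain ⟨c, rfl⟩ := germ_surj z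
  obtain ⟨d, rfl⟩ := germ_surj f
  rw [germ_comp_ofFun, mem_delta] at hst
  obtain ⟨A, hA, i, hi⟩ := hst
  rw [germ_comp, ofFun_maps] at hz
  obtain ⟨j, hj⟩ := hz
  obtain ⟨k, hk⟩ := d.comp_maps (genericSeq S)
  -- The finite set of values of the standard element is itself an index of the filter of
  -- enumerations.
  obtain ⟨l, hl⟩ := d.maps_cont hA.toFinset
  obtain ⟨m, hm⟩ := H.directed i j
  obtain ⟨n, hn⟩ := H.directed k l
  obtain ⟨p, hp⟩ := H.directed m n
  rw [germ_comp_ofFun, mem_ySub]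
  refine ⟨p, fun v hv => ?_⟩
  obtain ⟨s, hs, h1⟩ := hi v (hm (hp hv).1).1
  obtain ⟨y, h2, h3⟩ := hj v (hm (hp hv).1).2
  obtain ⟨t, e, h4, ⟨_, h5⟩, h6⟩ := hk v (hn (hp hv).2).1
  obtain ⟨t', h7, h8⟩ := hl v (hn (hp hv).2).2
  obtain rfl := h4.unique h8
  obtain ⟨y', h9, rfl⟩ := ContMap.post_maps.1 h1
  obtain rfl := h2.unique h9
  refine ⟨_, ?_, ContMap.post_maps.2 ⟨y, h2, rfl⟩⟩
  have e1 : y.2 = (t, PUnit.unit) := (h3.unique h6).trans h5.symm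
  change y.1 ∈ y.2.1
  rw [e1]
  exact h7 _ (hA.mem_toFinset.2 hs)

theorem forces_hyper_genericSeq (S : Ty L.Base) :
    Forces M (enumerations (S.interp M.carrier)) (.hyper (.var (.zero (Γ := []) (S := .seq S))))
      (germ (genericSeq (S.interp M.carrier))) := by
  refine forces_all.2 fun H₀ f₀ z₀ hz₀ => forces_imp.2 fun H h hst => ?_
  refine mem_genericSeq (z := h ≫ z₀) (f := h ≫ f₀) ?_ hst
  exact (Category.assoc _ _ _).trans ((congrArg _ hz₀).trans (Category.assoc _ _ _).symm)

/-- The generic sequence is a witness over `enumerations`, and this filter alone covers the terminal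
object because every finite set can be listed. Empty and finite S need no separate treatment. -/
theorem holds_ex_hyper (S : Ty L.Base) :
    Holds M (.ex (.seq S) (.hyper (.var .zero))) := by
  refine forces_ex.2 ⟨Unit, inferInstance, fun _ => enumerations (S.interp M.carrier),
    fun _ => germ ((genericSeq _).post Prod.snd), fun _ => ⟨_, forces_hyper_genericSeq S, ?_⟩,
    covers_of_rep _ fun j => ⟨⟨⟩, fun v _ => ?_⟩⟩
  · exact (germ_comp_ofFun _ _).trans (Category.comp_id _).symm
  · obtain ⟨w, hw⟩ := enumerations_nonempty (j ())
    -- The generic sequence is defined on the base set of index ∅, which imposes no condition on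
    -- `w`.
    exact ⟨(), w, hw, fun x hx => absurd hx (Finset.notMem_empty (α := S.interp M.carrier) x), rfl⟩

end

end FilterTopos

theorem mainTheorem5 (L : Lang.{w₁, w₂, w₃}) (M : Interp.{u} L) :
    (∀ (S : Ty L.Base) (Φ : Formula L [S]), Holds M (.ex S Φ) →
      ∀ (Γ : List (Ty L.Base)) (φ : Formula L (S :: Γ)), φ.IsInternal →
        Holds M (Formula.closure
          (.imp (.all S (.imp (Φ.weaken Γ) φ)) (.exSt S φ)))) ∧
    (∀ (S : Ty L.Base) (Γ : List (Ty L.Base)) (φ : Formula L (.seq S :: Γ)), φ.IsInternal →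
      Holds M (Formula.closure (.imp (.allHyp S φ) (.exSt (.seq S) φ)))) :=
  ⟨fun _ _ h _ _ hφ => holds_exSt_of_holds_ex h hφ,
    -- Weakening `hyper` of the single variable computes to `hyper` of the newest variable in the
    -- larger context, so the premise is `allHyp` by definitional unfolding.
    fun S _ _ hφ => holds_exSt_of_holds_ex (holds_ex_hyper S) hφ⟩
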